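/- **Setting.** Let $\mathcal A$ be the algebra of formal series $$f=c_0I+\sum_{n\ge1}\Bigl(\sum_{i_1+\dots+i_k=n}c_{i_1,\dots,i_k}X_{i_1}\cdots X_{i_k}\Bigr)t^n,\qquad c_0,c_{i_1,\dots,i_k}\in\mathbb C,$$ in free noncommutative variables $X_1,X_2,\dots$, and let $G\subset\mathcal A$ be the group of those with $c_0=1$, both with the weakest topology making all coefficients continuous. Let $T>0$ and let $X$ be the set of sequences $a=(a_1,a_2,\dots)$ in $L^\infty([0,T];\mathbb C)$ with $\sup_i\|a_i\|_\infty^{1/i}<\infty$. For $a\in X$ let $E(a)=F_a(T)\in G$, where $F_a$ is the solution (by Picard iteration) of $F'=\bigl(\sum_{i\ge1}a_i(x)X_it^i\bigr)F$, $F(0)=I$; its coefficient at $X_{i_1}\cdots X_{i_k}$ is $\int_{0\le s_k\le\dots\le s_1\le T}a_{i_1}(s_1)\cdots a_{i_k}(s_k)\,ds$. The set $E(X)$ is a subgroup of $G$ (the group of paths $G(X)$); the group of formal paths $G_f(X)$ is its closure in $G$. Let $G[[r]]$ be the set of formal series $r+\sum_{i\ge1}d_ir^{i+1}$, $d_i\in\mathbb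 C$, with the weakest topology making all $d_i$ continuous. The first return map $\widehat P:G_f(X)\to G[[r]]$ is $$\widehat P(g)=r+\sum_{i\ge1}\Bigl(\sum_{i_1+\dots+i_k=i}p_{i_1,\dots,i_k}(i)\,c_{i_k,\dots,i_1}(g)\Bigr)r^{i+1},\qquad p_{i_1,\dots,i_k}(x)=\prod_{j=1}^k(x-i_1-\dots-i_j+1),$$ where $c_{i_k,\dots,i_1}(g)$ is the coefficient of $g$ at $X_{i_k}\cdots X_{i_1}$. Let $D$ and $L_0$ be the operators of differentiation and of left translation $\sum c_kz^k\mapsto\sum c_{k+1}z^k$ on $\mathbb C[[z]]$, and let $\Psi$ be the homomorphism from $\mathcal A$ to formal series in $t$ with operator coefficients given by $\Psi(X_i)=DL_0^{i-1}$ (applied to each coefficient of $t^n$). Put $S=\Psi(G_f(X))$. The group of formal centers is $\widehat{\mathcal C}_f=\{g\in G_f(X):\Psi(g)=I\}$. Let $L=\{\sum_{n\ge1}c_nX_nt^n: c_n\in\mathbb C\}$, let $PL$ be the subgroup of $G$ generated by the elements $e^h$, $h\in L$ (the group of piecewise linear formal paths), and let $\widehat{\mathcal C}_{PL}=\widehat{\mathcal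 C}_f\cap PL$. Let $A$ be the linear map $A\bigl(\sum g_nDL_0^{n-1}t^n\bigr)=\sum g_nX_nt^n$. **Proposition 3.14.** The following data are well defined: $PL\subset G_f(X)$; there is a bijection $\Phi:S\to G[[r]]$ with $\widehat P=\Phi\circ\Psi$ on $G_f(X)$; and $\widehat{\mathcal C}_f=\{g\in G_f(X):\widehat P(g)=r\}$. Define $$T_{PL}=\exp\circ A\circ\log\circ\Phi^{-1}\ \text{ on } G[[r]],\qquad s(a,b)=(A\circ\Psi\circ\log)(e^a\cdot e^b)\in L\quad(a,b\in L).$$ Then: 1. the map $\widetilde T_{PL}(s,g)=T_{PL}(s)\cdot g$ is a homeomorphism of $G[[r]]\times\widehat{\mathcal C}_{PL}$ onto $PL$; 2. $\widehat{\mathcal C}_{PL}$ is the group generated by the elements $e^a\cdot e^b\cdot e^{-s(a,b)}$, $a,b\in L$; 3. $\widehat{\mathcal C}_{PL}$ is a dense subgroup of $\widehat{\mathcal C}_f$. -/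

import Mathlib

open MeasureTheory Topology

noncomputable section

namespace CenterProblem

open PowerSeries (mk coeff constantCoeff)

/-! ### The algebra of homogeneous noncommutative series -/

/-- Monomials `X_{i₁} ⋯ X_{i_k}` in the free noncommutative variables `X₁, X₂, …`. -/
abbrev Word : Type := FreeMonoid ℕ+

/-- The weight `i₁ + ⋯ + i_k` of the monomial `X_{i₁} ⋯ X_{i_k}`. -/
def weight (w : Word) : ℕ := (w.toList.map (fun i : ℕ+ => (i : ℕ))).sum

/-- The algebra `ℂ⟨X₁, X₂, …⟩` of noncommutative polynomials. -/
abbrev NCPoly : Type := MonoidAlgebra ℂ Word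

/-- The algebra `ℂ⟨X₁, X₂, …⟩[[t]]`. -/
abbrev NCSeries : Type := PowerSeries NCPoly

/-- `V_n`, the linear span of the monomials of weight `n`. -/
def homogeneousPart (n : ℕ) : Submodule ℂ NCPoly where
  carrier := {p | ∀ w : Word, weight w ≠ n → p.coeff w = 0}
  zero_mem' := by intro w _; simp
  add_mem' := by
    intro p q hp hq w hw
    simp [hp w hw, hq w hw]
  smul_mem' := by
    intro c p hp w hw
    simp [hp w hw]

/-- The coefficient `c_{i₁,…,i_k}` of `X_{i₁} ⋯ X_{i_k} t^{i₁+⋯+i_k}`. -/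
def wordCoeff (w : Word) (f : NCSeries) : ℂ := (coeff (weight w) f).coeff w

theorem weight_mul (u v : Word) : weight (u * v) = weight u + weight v := by
  simp [weight]

open Classical in
/-- The finitely many ways of cutting a word into two pieces. -/
def splits (w : Word) : Finset (Word × Word) :=
  (Finset.range (w.length + 1)).image fun k =>
    (FreeMonoid.ofList (w.toList.take k), FreeMonoid.ofList (w.toList.drop k))

theorem mem_splits {w : Word} {p : Word × Word} : p ∈ splits w ↔ p.1 * p.2 = w := by
  classical
  constructor
  · intro h
    obtain ⟨k, _, rfl⟩ := Finset.mem_image.1 h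
    exact List.take_append_drop k w.toList
  · rintro rfl
    refine Finset.mem_image.2 ⟨p.1.length, ?_, ?_⟩
    · simp [FreeMonoid.length_mul]
    · obtain ⟨u, v⟩ := p
      refine Prod.ext ?_ ?_
      · exact List.take_left (l₁ := u.toList) (l₂ := v.toList)
      · exact List.drop_left (l₁ := u.toList) (l₂ := v.toList)

theorem coeff_mul_splits (p q : NCPoly) (w : Word) :
    (p * q).coeff w = ∑ x ∈ splits w, p.coeff x.1 * q.coeff x.2 :=
  MonoidAlgebra.coeff_mul_antidiag p q w (splits w) mem_splits

theorem homogeneousPart_mul {m n : ℕ} {p q : NCPoly} (hp : p ∈ homogeneousPart m)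
    (hq : q ∈ homogeneousPart n) : p * q ∈ homogeneousPart (m + n) := by
  intro w hw
  rw [coeff_mul_splits]
  refine Finset.sum_eq_zero fun x hx => ?_
  have h := mem_splits.1 hx
  by_cases h1 : weight x.1 = m
  · have h2 : weight x.2 ≠ n := by
      rintro h2
      apply hw
      rw [← h, weight_mul, h1, h2]
    rw [hq _ h2, mul_zero]
  · rw [hp _ h1, zero_mul]

theorem single_mem_homogeneousPart (w : Word) (c : ℂ) :
    (MonoidAlgebra.single w c : NCPoly) ∈ homogeneousPart (weight w) := by
  intro v hv
  have : w ≠ v := by rintro rfl; exact hv rfl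
  simp [MonoidAlgebra.coeff_single, this]

theorem one_mem_homogeneousPart : (1 : NCPoly) ∈ homogeneousPart 0 :=
  single_mem_homogeneousPart 1 1

/-- The algebra `𝒜` of the series `∑ fₙ tⁿ` with `fₙ ∈ Vₙ`. -/
def seriesAlgebra : Subalgebra ℂ NCSeries where
  carrier := {f | ∀ n, coeff n f ∈ homogeneousPart n}
  mul_mem' := by
    intro f g hf hg n
    rw [PowerSeries.coeff_mul]
    refine Submodule.sum_mem _ fun x hx => ?_
    rw [← Finset.HasAntidiagonal.mem_antidiagonal.1 hx]
    exact homogeneousPart_mul (hf _) (hg _)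
  add_mem' := by
    intro f g hf hg n
    rw [map_add]
    exact Submodule.add_mem _ (hf n) (hg n)
  algebraMap_mem' := by
    intro c n
    rw [Algebra.algebraMap_eq_smul_one, PowerSeries.coeff_smul, PowerSeries.coeff_one]
    refine Submodule.smul_mem _ _ ?_
    split_ifs with h
    · rw [h]; exact one_mem_homogeneousPart
    · exact Submodule.zero_mem _

theorem wordCoeff_mul {f g : NCSeries} (hf : f ∈ seriesAlgebra) (hg : g ∈ seriesAlgebra)
    (w : Word) :
    wordCoeff w (f * g) = ∑ x ∈ splits w, wordCoeff x.1 f * wordCoeff x.2 g := by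
  have hc : ∀ (h : NCPoly →+ ℂ) (s : Finset (ℕ × ℕ)) (F : ℕ × ℕ → NCPoly),
      h (∑ y ∈ s, F y) = ∑ y ∈ s, h (F y) := fun h s F => map_sum h F s
  let ev : NCPoly →+ ℂ :=
    { toFun := fun p => p.coeff w, map_zero' := by simp, map_add' := by intros; simp }
  have h1 : wordCoeff w (f * g) =
      ∑ y ∈ Finset.HasAntidiagonal.antidiagonal (weight w), (coeff y.1 f * coeff y.2 g).coeff w := by
    unfold wordCoeff
    rw [PowerSeries.coeff_mul]
    exact hc ev _ _
  rw [h1]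
  simp_rw [coeff_mul_splits]
  rw [Finset.sum_comm]
  refine Finset.sum_congr rfl fun x hx => ?_
  have h := mem_splits.1 hx
  rw [Finset.sum_eq_single (weight x.1, weight x.2)]
  · rfl
  · rintro ⟨i, j⟩ hij hne
    by_cases hi : weight x.1 = i
    · have hj : weight x.2 ≠ j := by
        rintro hj
        exact hne (by rw [hi, hj])
      rw [hg j _ hj, mul_zero]
    · rw [hf i _ hi, zero_mul]
  · intro hn
    exact absurd (Finset.HasAntidiagonal.mem_antidiagonal.2 (by rw [← h, weight_mul])) hn

/-- The word `(i₁, …, i_k)` of a composition `i₁ + ⋯ + i_k = n`. -/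
def compWord {n : ℕ} (c : Composition n) : Word :=
  FreeMonoid.ofList (c.blocks.pmap (fun i h => Nat.toPNat i h) fun _ h => c.blocks_pos h)

theorem weight_compWord {n : ℕ} (c : Composition n) : weight (compWord c) = n := by
  have h : (c.blocks.pmap (fun i h => Nat.toPNat i h) fun _ h => c.blocks_pos h).map
      (fun i : ℕ+ => (i : ℕ)) = c.blocks := by
    rw [List.map_pmap]
    exact (List.pmap_eq_map (f := fun i : ℕ => i) _).trans (List.map_id' _)
  exact (congrArg List.sum h).trans c.blocks_sum

theorem compWord_injective {n : ℕ} : Function.Injective (compWord (n := n)) := by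
  intro c d h
  have hb : ∀ e : Composition n, ((compWord e).toList).map (fun i : ℕ+ => (i : ℕ)) = e.blocks := by
    intro e
    show (e.blocks.pmap (fun i h => Nat.toPNat i h) fun _ h => e.blocks_pos h).map
      (fun i : ℕ+ => (i : ℕ)) = e.blocks
    rw [List.map_pmap]
    exact (List.pmap_eq_map (f := fun i : ℕ => i) _).trans (List.map_id' _)
  exact Composition.ext (by rw [← hb c, ← hb d, h])

theorem exists_compWord (w : Word) : ∃ k : Composition (weight w), compWord k = w := by
  refine ⟨⟨w.toList.map (fun i : ℕ+ => (i : ℕ)), ?_, rfl⟩, ?_⟩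
  · intro i hi
    obtain ⟨j, _, rfl⟩ := List.mem_map.1 hi
    exact j.pos
  · show List.pmap _ (List.map _ (w.toList)) _ = w.toList
    rw [List.pmap_map]
    exact (List.pmap_eq_map (f := fun i : ℕ+ => i) _).trans (List.map_id' _)

theorem blocks_zero (k : Composition 0) : k.blocks = [] := by
  have h1 := k.blocks_length
  have h2 := k.length_le
  exact List.length_eq_zero_iff.1 (by omega)

theorem compWord_zero (k : Composition 0) : compWord k = 1 := by
  have h : (compWord k).length = k.blocks.length := List.length_pmap
  rw [blocks_zero] at h
  exact FreeMonoid.length_eq_zero.1 h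

/-- The series `∑ₙ (∑_{i₁+⋯+i_k=n} c_{i₁,…,i_k} X_{i₁} ⋯ X_{i_k}) tⁿ`. -/
def ofWordCoeff (c : Word → ℂ) : NCSeries :=
  mk fun n => ∑ k : Composition n, MonoidAlgebra.single (compWord k) (c (compWord k))

theorem ofWordCoeff_mem (c : Word → ℂ) : ofWordCoeff c ∈ seriesAlgebra := by
  intro n
  rw [ofWordCoeff, PowerSeries.coeff_mk]
  refine Submodule.sum_mem _ fun k _ => ?_
  have := single_mem_homogeneousPart (compWord k) (c (compWord k))
  rwa [weight_compWord] at this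

theorem wordCoeff_ofWordCoeff (c : Word → ℂ) (w : Word) : wordCoeff w (ofWordCoeff c) = c w := by
  classical
  obtain ⟨k, hk⟩ := exists_compWord w
  rw [wordCoeff, ofWordCoeff, PowerSeries.coeff_mk, MonoidAlgebra.coeff_sum, Finsupp.finsetSum_apply,
    Finset.sum_eq_single k]
  · simp [hk]
  · intro j _ hj
    have : compWord j ≠ w := fun h => hj (compWord_injective (h.trans hk.symm))
    simp [MonoidAlgebra.coeff_single, this]
  · simp

/-! ### The group `G` -/

/-- `G`: the series `∑ fₙ tⁿ` with `fₙ ∈ Vₙ` and `f₀ = 1`. -/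
def SeriesGroup : Type := {f : NCSeries // f ∈ seriesAlgebra ∧ constantCoeff f = 1}

instance : CoeOut SeriesGroup NCSeries := ⟨Subtype.val⟩

theorem inv_mem_seriesAlgebra {f g : NCSeries} (hf : f ∈ seriesAlgebra)
    (hf1 : constantCoeff f = 1) (hfg : f * g = 1) : g ∈ seriesAlgebra := by
  intro n
  induction n using Nat.strong_induction_on with
  | _ n ih =>
    have h := congrArg (coeff n) hfg
    have h1 : coeff n (1 : NCSeries) ∈ homogeneousPart n := (one_mem seriesAlgebra) n
    rw [← h, PowerSeries.coeff_mul, ← Finset.add_sum_erase _ _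
      (show (0, n) ∈ Finset.HasAntidiagonal.antidiagonal n by simp)] at h1
    rw [PowerSeries.coeff_zero_eq_constantCoeff_apply, hf1, one_mul] at h1
    refine (Submodule.add_mem_iff_left _ ?_).1 h1
    refine Submodule.sum_mem _ fun x hx => ?_
    obtain ⟨hne, hx⟩ := Finset.mem_erase.1 hx
    have hx := Finset.HasAntidiagonal.mem_antidiagonal.1 hx
    have hlt : x.2 < n := by
      rcases Nat.eq_zero_or_pos x.1 with h0 | h0
      · exact absurd (Prod.ext h0 (by simp only; omega)) hne
      · omega
    rw [← hx]
    rw [← hx] at hlt ih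
    exact homogeneousPart_mul (hf _) (ih _ hlt)

instance : Group SeriesGroup where
  mul f g := ⟨f.1 * g.1, mul_mem f.2.1 g.2.1, by rw [map_mul, f.2.2, g.2.2, one_mul]⟩
  one := ⟨1, one_mem _, map_one _⟩
  inv f := ⟨PowerSeries.invOfUnit f.1 1,
    inv_mem_seriesAlgebra f.2.1 f.2.2 (PowerSeries.mul_invOfUnit _ _ f.2.2),
    by rw [PowerSeries.constantCoeff_invOfUnit]; simp⟩
  mul_assoc f g h := Subtype.ext (mul_assoc f.1 g.1 h.1)
  one_mul f := Subtype.ext (one_mul f.1)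
  mul_one f := Subtype.ext (mul_one f.1)
  inv_mul_cancel f := Subtype.ext (PowerSeries.invOfUnit_mul _ _ f.2.2)

theorem SeriesGroup.coe_mul (f g : SeriesGroup) :
    ((f * g : SeriesGroup) : NCSeries) = (f : NCSeries) * (g : NCSeries) := rfl

theorem SeriesGroup.coe_one : ((1 : SeriesGroup) : NCSeries) = 1 := rfl

/-- The weakest topology in which all coefficients `c_{i₁,…,i_k}` are continuous. -/
instance : TopologicalSpace SeriesGroup :=
  TopologicalSpace.induced (fun (f : SeriesGroup) (w : Word) => wordCoeff w (f : NCSeries))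
    Pi.topologicalSpace

theorem continuous_wordCoeff (w : Word) :
    Continuous fun f : SeriesGroup => wordCoeff w (f : NCSeries) :=
  continuous_pi_iff.1 (continuous_induced_dom (f := fun (f : SeriesGroup) (v : Word) =>
    wordCoeff v (f : NCSeries))) w

theorem continuous_seriesGroup_iff {Y : Type*} [TopologicalSpace Y] {φ : Y → SeriesGroup} :
    Continuous φ ↔ ∀ w, Continuous fun y => wordCoeff w (φ y : NCSeries) := by
  rw [continuous_induced_rng, continuous_pi_iff]
  rfl

theorem wordCoeff_one_eq (f : SeriesGroup) : wordCoeff 1 (f : NCSeries) = 1 := by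
  have h : coeff 0 f.1 = 1 := by
    rw [PowerSeries.coeff_zero_eq_constantCoeff_apply, f.2.2]
  show (coeff 0 f.1).coeff 1 = 1
  rw [h]
  simp [MonoidAlgebra.one_def]

instance : IsTopologicalGroup SeriesGroup where
  continuous_mul := by
    rw [continuous_seriesGroup_iff]
    intro w
    have : (fun y : SeriesGroup × SeriesGroup => wordCoeff w ((y.1 * y.2 : SeriesGroup) : NCSeries))
        = fun y => ∑ x ∈ splits w, wordCoeff x.1 (y.1 : NCSeries) * wordCoeff x.2 (y.2 : NCSeries) :=
      funext fun y => wordCoeff_mul y.1.2.1 y.2.2.1 w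
    rw [this]
    exact continuous_finsetSum _ fun x _ =>
      ((continuous_wordCoeff x.1).comp continuous_fst).mul
        ((continuous_wordCoeff x.2).comp continuous_snd)
  continuous_inv := by
    classical
    rw [continuous_seriesGroup_iff]
    intro w
    induction hn : w.length using Nat.strong_induction_on generalizing w with
    | _ n ih =>
      by_cases hw : w = 1
      · subst hw
        simp only [wordCoeff_one_eq]
        exact continuous_const
      · have key : ∀ y : SeriesGroup, wordCoeff w ((y⁻¹ : SeriesGroup) : NCSeries) =
            -∑ x ∈ (splits w).erase (1, w),
              wordCoeff x.1 (y : NCSeries) * wordCoeff x.2 ((y⁻¹ : SeriesGroup) : NCSeries) := by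
          intro y
          have h := wordCoeff_mul y.2.1 (y⁻¹).2.1 w
          have h0 : wordCoeff w (y.1 * (y⁻¹).1) = 0 := by
            rw [← SeriesGroup.coe_mul, mul_inv_cancel, SeriesGroup.coe_one]
            unfold wordCoeff
            rw [PowerSeries.coeff_one]
            split_ifs
            · simp [MonoidAlgebra.one_def, MonoidAlgebra.coeff_single, Ne.symm hw]
            · simp
          rw [h0, ← Finset.add_sum_erase _ _
            (mem_splits.2 (one_mul w) : ((1 : Word), w) ∈ splits w), wordCoeff_one_eq,
            one_mul] at h
          exact eq_neg_of_add_eq_zero_left h.symm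
        simp_rw [key]
        refine (continuous_finsetSum _ fun x hx => ?_).neg
        obtain ⟨hne, hx⟩ := Finset.mem_erase.1 hx
        have hx := mem_splits.1 hx
        refine (continuous_wordCoeff x.1).mul (ih _ ?_ x.2 rfl)
        have hl : x.1.length + x.2.length = n := by
          rw [← hn, ← hx, FreeMonoid.length_mul]
        have : x.1.length ≠ 0 := by
          intro h0
          have h1 : x.1 = 1 := FreeMonoid.length_eq_zero.1 h0
          apply hne
          refine Prod.ext h1 ?_
          rw [h1, one_mul] at hx
          exact hx
        omega

/-! ### Exponential and logarithm of power series -/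

section ExpLog

variable {R : Type*} [Ring R] [Algebra ℂ R]

/-- `e^f = ∑ f^k / k!` for a series `f` in `t` without constant term
(then only `k ≤ n` contributes to the coefficient of `tⁿ`). -/
def expSeries (f : PowerSeries R) : PowerSeries R :=
  mk fun n => ∑ k ∈ Finset.range (n + 1), ((k.factorial : ℂ)⁻¹) • coeff n (f ^ k)

/-- `log f = -∑_{k≥1} (1 - f)^k / k` for a series `f` in `t` with constant term `1`
(then only `k ≤ n` contributes to the coefficient of `tⁿ`). -/
def logSeries (f : PowerSeries R) : PowerSeries R :=
  mk fun n => -∑ k ∈ Finset.Icc 1 n, ((k : ℂ)⁻¹) • coeff n ((1 - f) ^ k)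

end ExpLog

/-- The Lie algebra `ℒ_G` of `G`: the elements of `𝒜` without constant term. -/
def seriesLie : Submodule ℂ NCSeries where
  carrier := {f | f ∈ seriesAlgebra ∧ constantCoeff f = 0}
  zero_mem' := ⟨zero_mem _, map_zero _⟩
  add_mem' := fun hf hg => ⟨add_mem hf.1 hg.1, by rw [map_add, hf.2, hg.2, add_zero]⟩
  smul_mem' := fun c f hf => ⟨Subalgebra.smul_mem _ hf.1 c, by
    have h := hf.2
    rw [← PowerSeries.coeff_zero_eq_constantCoeff_apply] at h ⊢
    rw [PowerSeries.coeff_smul, h, smul_zero]⟩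

/-- The exponential map `ℒ_G → G`. -/
def expG (h : seriesLie) : SeriesGroup :=
  ⟨expSeries (h : NCSeries), by
    intro n
    rw [expSeries, PowerSeries.coeff_mk]
    exact Submodule.sum_mem _ fun k _ =>
      Submodule.smul_mem _ _ (pow_mem h.2.1 k n), by
    rw [← PowerSeries.coeff_zero_eq_constantCoeff_apply, expSeries, PowerSeries.coeff_mk]
    simp⟩

/-- The element `∑ cₙ Xₙ tⁿ` of `ℒ_G`. -/
def linearElement (c : ℕ+ → ℂ) : seriesLie :=
  ⟨mk fun n => if h : 0 < n then
      MonoidAlgebra.single (FreeMonoid.of (⟨n, h⟩ : ℕ+)) (c ⟨n, h⟩) else 0, by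
    intro n
    rw [PowerSeries.coeff_mk]
    split_ifs with h
    · have := single_mem_homogeneousPart (FreeMonoid.of (⟨n, h⟩ : ℕ+)) (c ⟨n, h⟩)
      have hw : weight (FreeMonoid.of (⟨n, h⟩ : ℕ+)) = n := by
        show [n].sum = n
        simp
      rwa [hw] at this
    · exact Submodule.zero_mem _, by
    rw [← PowerSeries.coeff_zero_eq_constantCoeff_apply, PowerSeries.coeff_mk]
    simp⟩

/-- `L`, the set of all `∑ cₙ Xₙ tⁿ`. -/
def L : Set seriesLie := Set.range linearElement

/-! ### Paths and formal paths -/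

/-- `L^∞(I_T)`, `I_T = [0, T]`. -/
abbrev LInfty (T : ℝ) : Type := Lp ℂ ⊤ ((volume : Measure ℝ).restrict (Set.Icc 0 T))

/-- `X`: the sequences `a = (a₁, a₂, …)` in `L^∞(I_T)` with `sup_i ‖a_i‖^{1/i} < ∞`. -/
def coeffSeqs (T : ℝ) : Set (ℕ+ → LInfty T) :=
  {a | BddAbove (Set.range fun i : ℕ+ => ‖a i‖ ^ (1 / ((i : ℕ) : ℝ)))}

/-- The coefficient of `X_{i₁} ⋯ X_{i_k} t^{i₁+⋯+i_k}` in the solution `F_a(x)`, `F_a(0) = 1`, of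
`F' = (∑ a_i(x) X_i tⁱ) F`, obtained by Picard iteration; that is, the iterated integral
`∫_{0 ≤ s_k ≤ ⋯ ≤ s₁ ≤ x} a_{i₁}(s₁) ⋯ a_{i_k}(s_k)`. -/
def picardCoeff {T : ℝ} (a : ℕ+ → LInfty T) : List ℕ+ → ℝ → ℂ
  | [], _ => 1
  | i :: w, x => ∫ s in (0 : ℝ)..x, a i s * picardCoeff a w s

/-- The monodromy `E(a) = F_a(T)`. -/
def monodromy {T : ℝ} (a : ℕ+ → LInfty T) : SeriesGroup :=
  ⟨ofWordCoeff fun w => picardCoeff a w.toList T, ofWordCoeff_mem _, by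
    rw [← PowerSeries.coeff_zero_eq_constantCoeff_apply, ofWordCoeff, PowerSeries.coeff_mk]
    have h : Fintype.card (Composition 0) = 1 := by simp [composition_card]
    simp [compWord_zero, picardCoeff, MonoidAlgebra.one_def, h]⟩

/-- The group of paths `G(X)`, as a subgroup of `G`: two elements of `X` define the same path when
all their iterated integrals, i.e. their monodromies, agree. (Since `E(a * b) = E(a) E(b)` for the
product of paths, the monodromies already form a subgroup.) -/
def pathGroup (T : ℝ) : Subgroup SeriesGroup := Subgroup.closure (monodromy '' coeffSeqs T)

/-- The group of formal paths `G_f(X)`: the completion of `G(X)`, i.e. its closure in `G`. -/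
def formalPathGroup (T : ℝ) : Subgroup SeriesGroup := (pathGroup T).topologicalClosure

/-- `PL`, the group generated by the elements `e^h`, `h = ∑ cₙ Xₙ tⁿ`. -/
def PL : Subgroup SeriesGroup := Subgroup.closure (expG '' L)

/-! ### Formal centers -/

/-- Linear operators on `ℂ[[z]]`. -/
abbrev Op : Type := Module.End ℂ (PowerSeries ℂ)

/-- Differentiation. -/
def opD : Op := (PowerSeries.derivative ℂ : Derivation ℂ _ _).toLinearMap

/-- The left translation `∑ c_k z^k ↦ ∑ c_{k+1} z^k`. -/
def opL : Op where
  toFun f := mk fun k => coeff (k + 1) f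
  map_add' f g := by ext; simp
  map_smul' c f := by ext; simp

/-- The algebra homomorphism `Ψ`, `Ψ(X_i) = D L^{i-1}`, on polynomials. -/
def psi : NCPoly →ₐ[ℂ] Op :=
  MonoidAlgebra.lift ℂ Op Word (FreeMonoid.lift fun i : ℕ+ => opD * opL ^ ((i : ℕ) - 1))

/-- The homomorphism `Ψ` on series, applied to each coefficient. -/
def Psi : NCSeries →+* PowerSeries Op := PowerSeries.map (psi : NCPoly →+* Op)

/-- The restriction of `Ψ` to the group `G`. -/
def PsiG : SeriesGroup →* PowerSeries Op where
  toFun g := Psi (g : NCSeries)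
  map_one' := map_one Psi
  map_mul' f g := map_mul Psi f.1 g.1

/-- The group of formal centers `Ĉ_f`: the kernel of `Ψ` on `G_f(X)`. -/
def formalCenters (T : ℝ) : Subgroup SeriesGroup := formalPathGroup T ⊓ PsiG.ker

/-- The group of formal centers in `PL`. -/
def plCenters (T : ℝ) : Subgroup SeriesGroup := formalCenters T ⊓ PL

/-! ### The first return map -/

/-- `G[[r]]`: formal series `r + ∑_{i≥1} d_i r^{i+1}`. -/
def ReturnSeries : Type := {f : PowerSeries ℂ // coeff 0 f = 0 ∧ coeff 1 f = 1}

/-- The weakest topology on `G[[r]]` in which all coefficients are continuous. -/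
instance : TopologicalSpace ReturnSeries :=
  TopologicalSpace.induced (fun (f : ReturnSeries) (n : ℕ) => coeff n f.1) Pi.topologicalSpace

/-- The series `r`. -/
def ReturnSeries.identity : ReturnSeries := ⟨PowerSeries.X, by simp, by simp⟩

/-- `p_{i₁,…,i_k}(t) = (t - i₁ + 1)(t - i₁ - i₂ + 1) ⋯ (t - i₁ - ⋯ - i_k + 1)`. -/
def returnPoly (l : List ℕ) (t : ℂ) : ℂ :=
  ∏ j ∈ Finset.range l.length, (t - ((l.take (j + 1)).sum : ℕ) + 1)

/-- The first return map
`P̂(g) = r + ∑_{i≥1} (∑_{i₁+⋯+i_k=i} p_{i₁,…,i_k}(i) I_{i₁,…,i_k}(g)) r^{i+1}`.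
The iterated integral `I_{i₁,…,i_k}` integrates `a_{i₁}(s₁) ⋯ a_{i_k}(s_k)` over
`0 ≤ s₁ ≤ ⋯ ≤ s_k ≤ T`, so by the Picard formula it is the coefficient at `X_{i_k} ⋯ X_{i₁}`.
For `i = 0` the only term is the empty one; it contributes `r`. -/
def firstReturn (g : SeriesGroup) : ReturnSeries :=
  ⟨mk fun n => match n with
      | 0 => 0
      | i + 1 => ∑ k : Composition i,
          returnPoly k.blocks i * wordCoeff (compWord k).reverse (g : NCSeries), by
    simp, by
    rw [PowerSeries.coeff_mk]
    have h1 : (FreeMonoid.reverse (1 : Word)) = 1 := rfl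
    have h : Fintype.card (Composition 0) = 1 := by simp [composition_card]
    simp [blocks_zero, compWord_zero, returnPoly, h1, wordCoeff_one_eq, h]⟩

/-- `S = Ψ(G_f(X))`. -/
def pathOperators (T : ℝ) : Set (PowerSeries Op) := PsiG '' (formalPathGroup T : Set SeriesGroup)

/-- The map `Φ : S → G[[r]]` with `P̂ = Φ ∘ Ψ` on `G_f(X)`: its value at `Ψ(g)` is `P̂(g)`. -/
def Phi (T : ℝ) (σ : PowerSeries Op) : ReturnSeries :=
  firstReturn (Function.invFunOn PsiG (formalPathGroup T : Set SeriesGroup) σ)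

instance : Nonempty (PowerSeries Op) := ⟨1⟩

/-- The inverse map `Φ⁻¹ : G[[r]] → S`. -/
def PhiInv (T : ℝ) (s : ReturnSeries) : PowerSeries Op :=
  Function.invFunOn (Phi T) (pathOperators T) s

/-- The linear map `A`, `∑ gₙ D L^{n-1} tⁿ ↦ ∑ gₙ Xₙ tⁿ`. Here `gₙ` is read off as the constant
coefficient of `gₙ D L^{n-1} zⁿ = gₙ`. -/
def liftA (f : PowerSeries Op) : seriesLie :=
  linearElement fun n => constantCoeff ((coeff (n : ℕ) f) (PowerSeries.X ^ (n : ℕ)))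

theorem opL_pow_X_pow (k m : ℕ) :
    (opL ^ k) (PowerSeries.X ^ (m + k) : PowerSeries ℂ) = PowerSeries.X ^ m := by
  induction k generalizing m with
  | zero => simp
  | succ k ih =>
    have h := ih (m + 1)
    rw [show m + 1 + k = m + (k + 1) by ring] at h
    rw [pow_succ', Module.End.mul_apply, h]
    ext j
    simp [opL, PowerSeries.coeff_X_pow]

theorem liftA_eq (c : ℕ+ → ℂ) :
    liftA (mk fun n => if h : 0 < n then c ⟨n, h⟩ • (opD * opL ^ (n - 1)) else 0) =
      linearElement c := by
  unfold liftA
  congr 1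
  funext n
  have h := opL_pow_X_pow ((n : ℕ) - 1) 1
  rw [show 1 + ((n : ℕ) - 1) = n by have := n.pos; omega] at h
  have h2 : constantCoeff (opD (PowerSeries.X : PowerSeries ℂ)) = 1 := by
    simp [opD]
  rw [PowerSeries.coeff_mk, dif_pos n.pos]
  rw [LinearMap.smul_apply, Module.End.mul_apply, h, pow_one,
    ← PowerSeries.coeff_zero_eq_constantCoeff_apply, PowerSeries.coeff_smul,
    PowerSeries.coeff_zero_eq_constantCoeff_apply, h2]
  exact mul_one _

/-- `T_PL = exp ∘ A ∘ log ∘ Φ⁻¹`. -/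
def TPL (T : ℝ) (s : ReturnSeries) : SeriesGroup := expG (liftA (logSeries (PhiInv T s)))

/-- `s(a, b) = (A ∘ Ψ ∘ log)(e^a e^b)`. -/
def sL (a b : seriesLie) : seriesLie :=
  liftA (Psi (logSeries ((expG a * expG b : SeriesGroup) : NCSeries)))

end CenterProblem

end

noncomputable section

namespace CenterProblem

open PowerSeries (mk coeff constantCoeff)

/-! ### Words -/

/-- The word `X_i w`. -/
def consWord (i : ℕ+) (w : Word) : Word := FreeMonoid.of i * w

@[simp] theorem weight_one : weight 1 = 0 := rfl

@[simp] theorem weight_of (i : ℕ+) : weight (FreeMonoid.of i) = i := by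
  show [(i : ℕ)].sum = i
  simp

theorem weight_consWord (i : ℕ+) (w : Word) : weight (consWord i w) = i + weight w := by
  rw [consWord, weight_mul, weight_of]

theorem length_consWord (i : ℕ+) (w : Word) : (consWord i w).length = w.length + 1 := by
  rw [consWord, FreeMonoid.length_mul, FreeMonoid.length_of, add_comm]

theorem consWord_ne_one (i : ℕ+) (w : Word) : consWord i w ≠ 1 := by
  intro h
  have := congrArg FreeMonoid.length h
  rw [length_consWord] at this
  simp at this

theorem consWord_inj {i j : ℕ+} {u v : Word} : consWord i u = consWord j v ↔ i = j ∧ u = v :=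
  List.cons_eq_cons (l := u.toList) (l' := v.toList)

@[elab_as_elim]
theorem word_induction {p : Word → Prop} (w : Word) (one : p 1)
    (cons : ∀ i w, p w → p (consWord i w)) : p w :=
  FreeMonoid.inductionOn' w one cons

theorem word_cases (w : Word) : w = 1 ∨ ∃ i v, w = consWord i v := by
  induction w using word_induction with
  | one => exact Or.inl rfl
  | cons i w _ => exact Or.inr ⟨i, w, rfl⟩

theorem weight_eq_zero {w : Word} : weight w = 0 ↔ w = 1 := by
  induction w using word_induction with
  | one => simp
  | cons i w _ =>
    have := i.pos
    refine ⟨fun h => ?_, fun h => absurd h (consWord_ne_one i w)⟩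
    have h2 := weight_consWord i w
    rw [h] at h2
    omega

theorem sum_splits_one {M : Type*} [AddCommMonoid M] (f : Word × Word → M) :
    ∑ x ∈ splits 1, f x = f (1, 1) := by
  have : splits (1 : Word) = {(1, 1)} := by
    ext ⟨u, v⟩
    rw [mem_splits, Finset.mem_singleton, Prod.mk.injEq]
    refine ⟨fun h => ?_, fun h => by rw [h.1, h.2, one_mul]⟩
    have h2 := congrArg FreeMonoid.length h
    replace h2 : u.length + v.length = 0 := by rwa [FreeMonoid.length_mul] at h2
    exact ⟨FreeMonoid.length_eq_zero.1 (by omega), FreeMonoid.length_eq_zero.1 (by omega)⟩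
  rw [this, Finset.sum_singleton]

/-- A cut lies either before the first letter or after it; in the second case it is a cut of `w`.
This recursion drives the inductions on words below. -/
theorem sum_splits_consWord {M : Type*} [AddCommMonoid M] (i : ℕ+) (w : Word)
    (f : Word × Word → M) :
    ∑ x ∈ splits (consWord i w), f x =
      f (1, consWord i w) + ∑ x ∈ splits w, f (consWord i x.1, x.2) := by
  classical
  have : splits (consWord i w) = insert (1, consWord i w)
      ((splits w).image fun x => (consWord i x.1, x.2)) := by
    ext ⟨u, v⟩
    rw [mem_splits, Finset.mem_insert, Finset.mem_image]
    constructor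
    · intro h
      rcases word_cases u with rfl | ⟨j, u, rfl⟩
      · left
        rw [← h, one_mul]
      · right
        have h : consWord j (u * v) = consWord i w := by rw [← h, consWord, consWord, mul_assoc]
        obtain ⟨rfl, h2⟩ := consWord_inj.1 h
        exact ⟨(u, v), mem_splits.2 h2, rfl⟩
    · rintro (h | ⟨⟨a, b⟩, h, h2⟩)
      · rw [Prod.mk.injEq] at h
        rw [h.1, h.2, one_mul]
      · rw [Prod.mk.injEq] at h2
        rw [← h2.1, ← h2.2, ← mem_splits.1 h, consWord, consWord, mul_assoc]
  rw [this, Finset.sum_insert, Finset.sum_image]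
  · rintro ⟨a, b⟩ _ ⟨c, d⟩ _ h
    rw [Prod.mk.injEq] at h
    exact Prod.ext (consWord_inj.1 h.1).2 h.2
  · rw [Finset.mem_image]
    rintro ⟨⟨a, b⟩, _, h⟩
    rw [Prod.mk.injEq] at h
    exact consWord_ne_one i a h.1

open Classical in
/-- The words of weight `n`. -/
def wordsOfWeight (n : ℕ) : Finset Word := Finset.univ.image (compWord (n := n))

theorem mem_wordsOfWeight {n : ℕ} {w : Word} : w ∈ wordsOfWeight n ↔ weight w = n := by
  classical
  rw [wordsOfWeight, Finset.mem_image]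
  constructor
  · rintro ⟨k, _, rfl⟩
    exact weight_compWord k
  · rintro rfl
    obtain ⟨k, hk⟩ := exists_compWord w
    exact ⟨k, Finset.mem_univ _, hk⟩

theorem sum_compWord {M : Type*} [AddCommMonoid M] (n : ℕ) (f : Word → M) :
    ∑ k : Composition n, f (compWord k) = ∑ w ∈ wordsOfWeight n, f w := by
  classical
  rw [wordsOfWeight, Finset.sum_image fun _ _ _ _ h => compWord_injective h]

theorem wordsOfWeight_zero : wordsOfWeight 0 = {1} := by
  ext w
  rw [mem_wordsOfWeight, Finset.mem_singleton, weight_eq_zero]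

/-- Summation over the words of positive weight by their first letter. -/
theorem sum_wordsOfWeight {M : Type*} [AddCommMonoid M] {n : ℕ} (hn : n ≠ 0) (f : Word → M) :
    ∑ w ∈ wordsOfWeight n, f w = ∑ p ∈ Finset.HasAntidiagonal.antidiagonal n,
      if 0 < p.1 then ∑ w ∈ wordsOfWeight p.2, f (consWord p.1.toPNat' w) else 0 := by
  classical
  have key : wordsOfWeight n = (Finset.HasAntidiagonal.antidiagonal n).biUnion fun p =>
      if 0 < p.1 then (wordsOfWeight p.2).image (consWord p.1.toPNat') else ∅ := by
    ext w
    rw [mem_wordsOfWeight, Finset.mem_biUnion]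
    constructor
    · rintro rfl
      rcases word_cases w with rfl | ⟨i, w, rfl⟩
      · exact absurd rfl hn
      · refine ⟨(i, weight w), ?_, ?_⟩
        · rw [Finset.HasAntidiagonal.mem_antidiagonal, ← weight_consWord]
        · rw [if_pos i.pos, Finset.mem_image]
          exact ⟨w, mem_wordsOfWeight.2 rfl, by rw [PNat.coe_toPNat']⟩
    · rintro ⟨⟨i, m⟩, hp, h⟩
      rw [Finset.HasAntidiagonal.mem_antidiagonal] at hp
      split_ifs at h with hi
      · obtain ⟨v, hv, rfl⟩ := Finset.mem_image.1 h
        rw [weight_consWord, mem_wordsOfWeight.1 hv, Nat.toPNat'_coe, if_pos hi]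
        exact hp
      · simp at h
  rw [key, Finset.sum_biUnion]
  · refine Finset.sum_congr rfl fun p _ => ?_
    split_ifs with h
    · exact Finset.sum_image fun _ _ _ _ h => (consWord_inj.1 h).2
    · rfl
  · rintro ⟨i, m⟩ hp ⟨j, m'⟩ hq hne
    rw [Finset.mem_coe, Finset.HasAntidiagonal.mem_antidiagonal] at hp hq
    rw [Function.onFun, Finset.disjoint_left]
    intro w h1 h2
    split_ifs at h1 with hi
    · split_ifs at h2 with hj
      · obtain ⟨u, hu, rfl⟩ := Finset.mem_image.1 h1
        obtain ⟨v, hv, h⟩ := Finset.mem_image.1 h2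
        have : ((j.toPNat' : ℕ+) : ℕ) = (i.toPNat' : ℕ+) := by rw [(consWord_inj.1 h).1]
        rw [Nat.toPNat'_coe, Nat.toPNat'_coe, if_pos hi, if_pos hj] at this
        simp only at hp hq
        exact hne (Prod.ext this.symm (by simp only; omega))
      · simp at h2
    · simp at h1

/-! ### Coefficients -/

theorem coeff_eq_sum_words {f : NCSeries} (hf : f ∈ seriesAlgebra) (n : ℕ) :
    coeff n f = ∑ w ∈ wordsOfWeight n, MonoidAlgebra.single w (wordCoeff w f) := by
  classical
  ext v
  rw [MonoidAlgebra.coeff_sum, Finsupp.finsetSum_apply]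
  simp only [MonoidAlgebra.coeff_single, Finsupp.single_apply]
  rw [Finset.sum_ite_eq']
  split_ifs with h
  · rw [wordCoeff, mem_wordsOfWeight.1 h]
  · exact hf n v fun h2 => h (mem_wordsOfWeight.2 h2)

theorem series_ext {f g : NCSeries} (hf : f ∈ seriesAlgebra) (hg : g ∈ seriesAlgebra)
    (h : ∀ w, wordCoeff w f = wordCoeff w g) : f = g := by
  ext1 n
  rw [coeff_eq_sum_words hf, coeff_eq_sum_words hg]
  simp_rw [h]

theorem SeriesGroup.ext_wordCoeff {f g : SeriesGroup}
    (h : ∀ w, wordCoeff w (f : NCSeries) = wordCoeff w (g : NCSeries)) : f = g :=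
  Subtype.ext (series_ext f.2.1 g.2.1 h)

theorem wordCoeff_mul_group (f g : SeriesGroup) (w : Word) :
    wordCoeff w ((f * g : SeriesGroup) : NCSeries) =
      ∑ x ∈ splits w, wordCoeff x.1 (f : NCSeries) * wordCoeff x.2 (g : NCSeries) :=
  wordCoeff_mul f.2.1 g.2.1 w

/-- The product of the numbers `c_i` over the letters of a word. -/
def wordProd (c : ℕ+ → ℂ) (w : Word) : ℂ := (w.toList.map c).prod

@[simp] theorem wordProd_one (c : ℕ+ → ℂ) : wordProd c 1 = 1 := rfl

theorem wordProd_consWord (c : ℕ+ → ℂ) (i : ℕ+) (w : Word) :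
    wordProd c (consWord i w) = c i * wordProd c w :=
  List.prod_cons

theorem wordCoeff_linearElement_of (c : ℕ+ → ℂ) (i : ℕ+) :
    wordCoeff (FreeMonoid.of i) (linearElement c : NCSeries) = c i := by
  rw [wordCoeff, weight_of, linearElement, PowerSeries.coeff_mk, dif_pos i.pos, MonoidAlgebra.coeff_single]
  exact Finsupp.single_eq_same

theorem wordCoeff_linearElement_of_ne (c : ℕ+ → ℂ) {w : Word} (h : ∀ i, w ≠ FreeMonoid.of i) :
    wordCoeff w (linearElement c : NCSeries) = 0 := by
  classical
  rw [wordCoeff, linearElement, PowerSeries.coeff_mk]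
  split_ifs with hw
  · rw [MonoidAlgebra.coeff_single, Finsupp.single_apply, if_neg fun h2 => h _ h2.symm]
  · rfl

/-- An element of `L` involves only one-letter words, so its `k`-th power involves exactly the words
with `k` letters. -/
theorem wordCoeff_linearElement_pow (c : ℕ+ → ℂ) (k : ℕ) (w : Word) :
    wordCoeff w ((linearElement c : NCSeries) ^ k) = if w.length = k then wordProd c w else 0 := by
  induction k generalizing w with
  | zero =>
    rw [pow_zero]
    split_ifs with h
    · rw [FreeMonoid.length_eq_zero] at h
      subst h
      exact wordCoeff_one_eq 1
    · rw [wordCoeff, PowerSeries.coeff_one, if_neg fun h2 => h (by rw [weight_eq_zero.1 h2]; rfl)]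
      rfl
  | succ k ih =>
    rw [pow_succ', wordCoeff_mul (linearElement c).2.1 (pow_mem (linearElement c).2.1 k)]
    rcases word_cases w with rfl | ⟨i, w, rfl⟩
    · rw [sum_splits_one, wordCoeff_linearElement_of_ne, zero_mul, if_neg]
      · simp
      · intro i h
        exact consWord_ne_one i 1 (by rw [consWord, mul_one]; exact h.symm)
    · rw [sum_splits_consWord, wordCoeff_linearElement_of_ne, zero_mul, zero_add,
        Finset.sum_eq_single (1, w)]
      · have h1 : consWord i 1 = FreeMonoid.of i := mul_one _
        rw [h1, wordCoeff_linearElement_of, ih]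
        simp only [length_consWord, Nat.add_right_cancel_iff, wordProd_consWord,
          mul_ite, mul_zero]
      · rintro ⟨u, v⟩ hx hne
        rw [mem_splits] at hx
        rw [wordCoeff_linearElement_of_ne, zero_mul]
        intro j h
        have h : consWord i u = consWord j 1 := h.trans (mul_one _).symm
        have hu := (consWord_inj.1 h).2
        subst hu
        exact hne (by rw [← hx, one_mul])
      · intro h
        exact absurd (mem_splits.2 (one_mul w)) h
      · intro j h
        exact consWord_ne_one j 1 (by rw [consWord, mul_one]; exact h.symm)

theorem length_le_weight (w : Word) : w.length ≤ weight w := by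
  induction w using word_induction with
  | one => simp
  | cons i w ih =>
    have := i.pos
    have h1 := weight_consWord i w
    have h2 := length_consWord i w
    omega

/-- Only the power whose exponent is the length of `w` contributes; it is within the truncation of
`expSeries` because length is at most weight. -/
theorem wordCoeff_expG (c : ℕ+ → ℂ) (w : Word) :
    wordCoeff w (expG (linearElement c) : NCSeries) =
      (w.length.factorial : ℂ)⁻¹ * wordProd c w := by
  have h : wordCoeff w (expG (linearElement c) : NCSeries) =
      ∑ k ∈ Finset.range (weight w + 1), (k.factorial : ℂ)⁻¹ *
        wordCoeff w ((linearElement c : NCSeries) ^ k) := by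
    show (coeff (weight w) (expSeries (linearElement c : NCSeries))).coeff w = _
    rw [expSeries, PowerSeries.coeff_mk, MonoidAlgebra.coeff_sum, Finsupp.finsetSum_apply]
    rfl
  rw [h]
  simp_rw [wordCoeff_linearElement_pow]
  rw [Finset.sum_eq_single w.length]
  · rw [if_pos rfl]
  · intro k _ hk
    rw [if_neg (Ne.symm hk), mul_zero]
  · intro h
    have := length_le_weight w
    rw [Finset.mem_range] at h
    omega

theorem continuous_wordProd (w : Word) : Continuous fun c : ℕ+ → ℂ => wordProd c w := by
  induction w using word_induction with
  | one => exact continuous_const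
  | cons i w ih =>
    simp_rw [wordProd_consWord]
    exact (continuous_apply i).mul ih

theorem continuous_expG_linearElement : Continuous fun c : ℕ+ → ℂ => expG (linearElement c) := by
  rw [continuous_seriesGroup_iff]
  intro w
  simp_rw [wordCoeff_expG]
  exact continuous_const.mul (continuous_wordProd w)

theorem linearElement_neg (c : ℕ+ → ℂ) : linearElement (-c) = -linearElement c := by
  apply Subtype.ext
  ext1 n
  show coeff n (linearElement (-c) : NCSeries) = coeff n (-(linearElement c : NCSeries))
  rw [map_neg, linearElement, linearElement, PowerSeries.coeff_mk, PowerSeries.coeff_mk]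
  split_ifs
  · exact MonoidAlgebra.single_neg _ _
  · exact neg_zero.symm

/-! ### Substitution of a noncommutative series into a power series -/

theorem coeff_pow_eq_zero {R : Type*} [Ring R] {f : PowerSeries R} (hf : constantCoeff f = 0) {k n : ℕ} (h : n < k) :
    coeff n (f ^ k) = 0 := by
  induction k generalizing n with
  | zero => omega
  | succ k ih =>
    rw [pow_succ, PowerSeries.coeff_mul]
    refine Finset.sum_eq_zero fun x hx => ?_
    rw [Finset.HasAntidiagonal.mem_antidiagonal] at hx
    by_cases h1 : x.1 < k
    · rw [ih h1, zero_mul]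
    · have h2 : x.2 = 0 := by omega
      rw [h2, PowerSeries.coeff_zero_eq_constantCoeff_apply, hf, mul_zero]

section Subst

variable {R : Type*} [Ring R] [Algebra ℂ R] {f : PowerSeries R}

/-- The series `∑ pₖ f^k`. -/
def substFun (f : PowerSeries R) (p : PowerSeries ℂ) : PowerSeries R :=
  mk fun n => ∑ k ∈ Finset.range (n + 1), coeff k p • coeff n (f ^ k)

theorem coeff_substFun (f : PowerSeries R) (p : PowerSeries ℂ) (n : ℕ) :
    coeff n (substFun f p) = ∑ k ∈ Finset.range (n + 1), coeff k p • coeff n (f ^ k) :=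
  PowerSeries.coeff_mk _ _

theorem coeff_substFun_of_le (hf : constantCoeff f = 0) (p : PowerSeries ℂ) {n N : ℕ}
    (h : n < N) : coeff n (substFun f p) = ∑ k ∈ Finset.range N, coeff k p • coeff n (f ^ k) := by
  rw [coeff_substFun]
  refine Finset.sum_subset (Finset.range_subset_range.2 h) fun k _ hk => ?_
  rw [Finset.mem_range] at hk
  rw [coeff_pow_eq_zero hf (by omega), smul_zero]

theorem coeff_substFun_congr {p q : PowerSeries ℂ} {n : ℕ} (h : ∀ k ≤ n, coeff k p = coeff k q) :
    coeff n (substFun f p) = coeff n (substFun f q) := by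
  rw [coeff_substFun, coeff_substFun]
  refine Finset.sum_congr rfl fun k hk => ?_
  rw [Finset.mem_range] at hk
  rw [h k (by omega)]

/-- For polynomials the substitution is evaluation, which is already a homomorphism. Truncation
carries the ring laws over to power series. -/
theorem substFun_coe (hf : constantCoeff f = 0) (p : Polynomial ℂ) :
    substFun f (p : PowerSeries ℂ) = Polynomial.aeval f p := by
  ext1 n
  have h := le_max_left (p.natDegree + 1) (n + 1)
  have h2 := le_max_right (p.natDegree + 1) (n + 1)
  rw [Polynomial.aeval_eq_sum_range' h, coeff_substFun_of_le hf _ h2, map_sum]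
  simp only [Polynomial.coeff_coe, PowerSeries.coeff_smul]

/-- Substitution of a series without constant term, as a homomorphism. -/
def substHom (hf : constantCoeff f = 0) : PowerSeries ℂ →+* PowerSeries R where
  toFun := substFun f
  map_one' := by
    rw [← Polynomial.coe_one, substFun_coe hf, map_one]
  map_zero' := by
    rw [← Polynomial.coe_zero, substFun_coe hf, map_zero]
  map_add' p q := by
    ext1 n
    simp only [coeff_substFun, map_add, add_smul, Finset.sum_add_distrib]
  map_mul' p q := by
    ext1 n
    -- Up to degree `n` only the truncation of a series at `n + 1` matters, so multiplicativity
    -- reduces to that of `Polynomial.aeval`.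
    have h : ∀ (s : PowerSeries ℂ) (k : ℕ), k ≤ n →
        coeff k (substFun f s) = coeff k (Polynomial.aeval f (PowerSeries.trunc (n + 1) s)) := by
      intro s k hk
      rw [← substFun_coe hf]
      refine coeff_substFun_congr fun j hj => ?_
      rw [Polynomial.coeff_coe, PowerSeries.coeff_trunc, if_pos (by omega)]
    have h2 : coeff n (substFun f (p * q)) = coeff n (substFun f
        ((PowerSeries.trunc (n + 1) p * PowerSeries.trunc (n + 1) q : Polynomial ℂ) :
          PowerSeries ℂ)) := by
      refine coeff_substFun_congr fun k hk => ?_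
      rw [Polynomial.coe_mul]
      exact PowerSeries.coeff_mul_eq_coeff_trunc_mul_trunc p q (by omega)
    rw [h2, substFun_coe hf, map_mul, PowerSeries.coeff_mul, PowerSeries.coeff_mul]
    refine Finset.sum_congr rfl fun x hx => ?_
    rw [Finset.HasAntidiagonal.mem_antidiagonal] at hx
    rw [h p x.1 (by omega), h q x.2 (by omega)]

theorem coeff_substHom (hf : constantCoeff f = 0) (p : PowerSeries ℂ) (n : ℕ) :
    coeff n (substHom hf p) = ∑ k ∈ Finset.range (n + 1), coeff k p • coeff n (f ^ k) :=
  coeff_substFun f p n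

theorem substHom_X (hf : constantCoeff f = 0) : substHom hf PowerSeries.X = f := by
  show substFun f PowerSeries.X = f
  rw [← Polynomial.coe_X, substFun_coe hf, Polynomial.aeval_X]

theorem expSeries_eq_substHom (hf : constantCoeff f = 0) :
    expSeries f = substHom hf (PowerSeries.exp ℂ) := by
  ext1 n
  rw [coeff_substHom, expSeries, PowerSeries.coeff_mk]
  refine Finset.sum_congr rfl fun k _ => ?_
  rw [PowerSeries.coeff_exp]
  simp

/-- The powers of `f` commute, so the scalar identity `exp(x) exp(-x) = 1` can be pushed through the
substitution `x ↦ f`. -/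
theorem expSeries_mul_expSeries_neg (hf : constantCoeff f = 0) :
    expSeries f * expSeries (-f) = 1 := by
  have h : expSeries (-f) = substHom hf (PowerSeries.evalNegHom (PowerSeries.exp ℂ)) := by
    ext1 n
    rw [coeff_substHom, expSeries, PowerSeries.coeff_mk]
    refine Finset.sum_congr rfl fun k _ => ?_
    rw [PowerSeries.evalNegHom, PowerSeries.coeff_rescale, PowerSeries.coeff_exp, neg_pow f,
      mul_comm, mul_smul]
    rcases neg_one_pow_eq_or ℂ k with hk | hk
    · have hk2 : (-1 : PowerSeries R) ^ k = 1 := by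
        rcases neg_one_pow_eq_one_iff_even (R := ℂ) (by norm_num) |>.1 hk with h
        exact h.neg_one_pow
      rw [hk, hk2]
      simp
    · have hk2 : (-1 : PowerSeries R) ^ k = -1 := by
        rcases neg_one_pow_eq_neg_one_iff_odd (R := ℂ) (by norm_num) |>.1 hk with h
        exact h.neg_one_pow
      rw [hk, hk2]
      simp
  rw [h, expSeries_eq_substHom hf, ← map_mul, PowerSeries.exp_mul_exp_neg_eq_one, map_one]

theorem logSeries_substHom (hf : constantCoeff f = 0) {p : PowerSeries ℂ}
    (hp : constantCoeff p = 1) : logSeries (substHom hf p) = substHom hf (logSeries p) := by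
  have hp' : constantCoeff (1 - p) = 0 := by rw [map_sub, map_one, hp, sub_self]
  ext1 n
  have h : ∀ m ∈ Finset.range (n + 1), coeff m (logSeries p) =
      -∑ k ∈ Finset.Icc 1 n, ((k : ℂ)⁻¹) * coeff m ((1 - p) ^ k) := by
    intro m hm
    rw [Finset.mem_range] at hm
    rw [logSeries, PowerSeries.coeff_mk]
    congr 1
    refine Finset.sum_subset (Finset.Icc_subset_Icc_right (by omega)) fun k hk hk2 => ?_
    rw [Finset.mem_Icc] at hk hk2
    rw [coeff_pow_eq_zero hp' (by omega), smul_zero]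
  rw [coeff_substHom, Finset.sum_congr rfl fun m hm => by rw [h m hm], logSeries,
    PowerSeries.coeff_mk]
  simp_rw [neg_smul, Finset.sum_smul, Finset.sum_neg_distrib]
  rw [Finset.sum_comm]
  congr 1
  refine Finset.sum_congr rfl fun k _ => ?_
  rw [← map_one (substHom hf), ← map_sub, ← map_pow, coeff_substHom, Finset.smul_sum]
  simp_rw [mul_smul]

/-- Termwise differentiation of `-∑ (1 - E)^k / k` gives the geometric sum `∑ (1 - E)^j` times `E =
1 - (1 - E)`. It telescopes to `1 - (1 - E)^(n+1)`, whose last term is invisible in degree `n`;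
hence the derivative of the logarithm is `1`. -/
theorem logSeries_exp : logSeries (PowerSeries.exp ℂ) = PowerSeries.X := by
  set E := PowerSeries.exp ℂ with hE
  have hE1 : constantCoeff (1 - E) = 0 := by
    rw [map_sub, map_one, hE, PowerSeries.constantCoeff_exp, sub_self]
  have hd : PowerSeries.derivative ℂ (1 - E) = -E := by
    rw [map_sub, PowerSeries.derivative_one, hE, PowerSeries.derivative_exp, zero_sub]
  have key : ∀ n, coeff (n + 1) (logSeries E) * (n + 1 : ℂ) = coeff n (1 : PowerSeries ℂ) := by
    intro n
    have h1 : coeff (n + 1) (logSeries E) * (n + 1 : ℂ) =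
        coeff n ((∑ j ∈ Finset.range (n + 1), (1 - E) ^ j) * (1 - (1 - E))) := by
      rw [logSeries, PowerSeries.coeff_mk, Finset.sum_mul, map_sum, neg_mul, Finset.sum_mul,
        ← Finset.sum_neg_distrib]
      refine Finset.sum_nbij' (fun k => k - 1) (fun j => j + 1) ?_ ?_ ?_ ?_ ?_
      · intro k hk
        rw [Finset.mem_Icc] at hk
        rw [Finset.mem_range]
        omega
      · intro j hj
        rw [Finset.mem_range] at hj
        rw [Finset.mem_Icc]
        omega
      · intro k hk
        rw [Finset.mem_Icc] at hk
        omega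
      · intro j _
        omega
      · intro k hk
        rw [Finset.mem_Icc] at hk
        obtain ⟨j, rfl⟩ : ∃ j, k = j + 1 := ⟨k - 1, by omega⟩
        have h2 := PowerSeries.coeff_derivative ((1 - E) ^ (j + 1)) n
        rw [PowerSeries.derivative_pow, hd] at h2
        rw [smul_eq_mul, mul_assoc, ← h2, sub_sub_cancel, Nat.add_sub_cancel, mul_neg, map_neg,
          mul_neg, neg_neg, mul_assoc, ← map_natCast (PowerSeries.C (R := ℂ)),
          PowerSeries.coeff_C_mul, ← mul_assoc, inv_mul_cancel₀, one_mul]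
        exact Nat.cast_ne_zero.2 (Nat.succ_ne_zero j)
    rw [h1, geom_sum_mul_neg, map_sub, coeff_pow_eq_zero hE1 (Nat.lt_succ_self n), sub_zero]
  ext1 n
  rcases n with _ | n
  · rw [logSeries, PowerSeries.coeff_mk]
    simp
  · have h := key n
    rw [PowerSeries.coeff_X]
    rw [PowerSeries.coeff_one] at h
    split_ifs at h with hn
    · subst hn
      simpa using h
    · rw [if_neg (by omega)]
      exact (mul_eq_zero.1 h).resolve_right (by exact_mod_cast Nat.succ_ne_zero n)

theorem logSeries_expSeries (hf : constantCoeff f = 0) : logSeries (expSeries f) = f := by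
  rw [expSeries_eq_substHom hf, logSeries_substHom hf (PowerSeries.constantCoeff_exp), logSeries_exp,
    substHom_X]

end Subst

/-! ### The action of `Ψ` on coefficients -/

/-- The product `∏ (k + i₁ + ⋯ + i_{m-1} + 1)` over the letters `i_m` of a word. -/
def shiftCoeff : List ℕ+ → ℕ → ℂ
  | [], _ => 1
  | i :: l, k => (k + 1) * shiftCoeff l (k + i)

theorem shiftCoeff_consWord (i : ℕ+) (w : Word) (k : ℕ) :
    shiftCoeff (consWord i w).toList k = (k + 1) * shiftCoeff w.toList (k + i) := rfl

theorem coeff_opL_pow (m k : ℕ) (f : PowerSeries ℂ) :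
    coeff k ((opL ^ m) f) = coeff (k + m) f := by
  induction m generalizing k with
  | zero => simp
  | succ m ih =>
    rw [pow_succ', Module.End.mul_apply]
    show coeff k (mk fun k => coeff (k + 1) ((opL ^ m) f)) = _
    rw [PowerSeries.coeff_mk, ih, add_right_comm, add_assoc]

theorem coeff_opD_opL_pow (i : ℕ+) (k : ℕ) (f : PowerSeries ℂ) :
    coeff k ((opD * opL ^ ((i : ℕ) - 1)) f) = (k + 1) * coeff (k + i) f := by
  rw [Module.End.mul_apply]
  show coeff k (PowerSeries.derivative ℂ ((opL ^ ((i : ℕ) - 1)) f)) = _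
  rw [PowerSeries.coeff_derivative, coeff_opL_pow, mul_comm]
  have := i.pos
  congr 3
  omega

theorem coeff_lift_apply (w : Word) (k : ℕ) (f : PowerSeries ℂ) :
    coeff k ((FreeMonoid.lift (fun i : ℕ+ => opD * opL ^ ((i : ℕ) - 1)) w : Op) f) =
      shiftCoeff w.toList k * coeff (k + weight w) f := by
  induction w using word_induction generalizing k with
  | one => simp [shiftCoeff]
  | cons i w ih =>
    rw [shiftCoeff_consWord, weight_consWord, consWord, map_mul, FreeMonoid.lift_eval_of,
      Module.End.mul_apply, coeff_opD_opL_pow, ih, mul_assoc, add_assoc]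

/-- `T n k g` is the factor by which `Ψ(g)` sends the coefficient of `z^(k+n)` to the coefficient
of `z^k` in degree `tⁿ`. -/
def transferCoeff (n k : ℕ) (g : SeriesGroup) : ℂ :=
  ∑ w ∈ wordsOfWeight n, shiftCoeff w.toList k * wordCoeff w (g : NCSeries)

/-- Every word of weight `n` acts as a weighted shift by `n` places, so the whole degree `tⁿ` does;
the operator series is thereby encoded by an array of numbers. -/
theorem coeff_PsiG (g : SeriesGroup) (n k : ℕ) (f : PowerSeries ℂ) :
    coeff k ((coeff n (PsiG g)) f) = transferCoeff n k g * coeff (k + n) f := by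
  show coeff k ((coeff n (PowerSeries.map (psi : NCPoly →+* Op) g.1)) f) = _
  rw [PowerSeries.coeff_map, coeff_eq_sum_words g.2.1, map_sum, LinearMap.sum_apply, map_sum,
    transferCoeff, Finset.sum_mul]
  refine Finset.sum_congr rfl fun w hw => ?_
  have h : psi (MonoidAlgebra.single w (wordCoeff w g.1)) = wordCoeff w g.1 •
      (FreeMonoid.lift (fun i : ℕ+ => opD * opL ^ ((i : ℕ) - 1)) w : Op) :=
    MonoidAlgebra.lift_single _ _ _
  have h2 : (psi : NCPoly →+* Op) (MonoidAlgebra.single w (wordCoeff w g.1)) =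
    psi (MonoidAlgebra.single w (wordCoeff w g.1)) := rfl
  rw [h2, h, LinearMap.smul_apply, PowerSeries.coeff_smul, coeff_lift_apply,
    mem_wordsOfWeight.1 hw, smul_eq_mul]
  ring

theorem PsiG_eq_iff {g h : SeriesGroup} :
    PsiG g = PsiG h ↔ ∀ n k, transferCoeff n k g = transferCoeff n k h := by
  constructor
  · intro e n k
    have hg := coeff_PsiG g n k (PowerSeries.X ^ (k + n))
    have hh := coeff_PsiG h n k (PowerSeries.X ^ (k + n))
    rw [e, hh, PowerSeries.coeff_X_pow_self, mul_one, mul_one] at hg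
    exact hg.symm
  · intro e
    ext1 n
    refine LinearMap.ext fun f => ?_
    ext1 k
    rw [coeff_PsiG, coeff_PsiG, e]

theorem transferCoeff_zero (k : ℕ) (g : SeriesGroup) : transferCoeff 0 k g = 1 := by
  rw [transferCoeff, wordsOfWeight_zero, Finset.sum_singleton, wordCoeff_one_eq, mul_one]
  rfl

theorem continuous_transferCoeff (n k : ℕ) : Continuous (transferCoeff n k) :=
  continuous_finsetSum _ fun w _ => continuous_const.mul (continuous_wordCoeff w)

/-! ### The first return map -/

theorem returnPoly_cons (i : ℕ) (l : List ℕ) (t : ℂ) :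
    returnPoly (i :: l) t = (t - i + 1) * returnPoly l (t - i) := by
  rw [returnPoly, List.length_cons, Finset.prod_range_succ', mul_comm]
  have h : ((List.take (0 + 1) (i :: l)).sum : ℕ) = i := by simp
  rw [h]
  · congr 1
    refine Finset.prod_congr rfl fun j _ => ?_
    rw [List.take_succ_cons, List.sum_cons]
    push_cast
    ring

theorem shiftCoeff_append (l : List ℕ+) (i : ℕ+) (k : ℕ) :
    shiftCoeff (l ++ [i]) k = shiftCoeff l k * (k + (l.map (fun i : ℕ+ => (i : ℕ))).sum + 1) := by
  induction l generalizing k with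
  | nil => simp [shiftCoeff]
  | cons j l ih =>
    rw [List.cons_append, shiftCoeff, ih, shiftCoeff, List.map_cons, List.sum_cons]
    push_cast
    ring

/-- At `t` equal to the total weight, `t - i₁ - ⋯ - i_j + 1` is one plus the weight of the letters
still to come. Read backwards, these are the factors produced by the successive operators `D
L^(i-1)`. -/
theorem returnPoly_reverse (l : List ℕ+) :
    returnPoly (l.map (fun i : ℕ+ => (i : ℕ))).reverse
      ((l.map (fun i : ℕ+ => (i : ℕ))).sum : ℕ) = shiftCoeff l 0 := by
  induction l using List.reverseRecOn with
  | nil => simp [returnPoly, shiftCoeff]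
  | append_singleton l i ih =>
    rw [shiftCoeff_append, List.map_append, List.reverse_append, List.sum_append, ← ih]
    simp only [List.map_cons, List.map_nil, List.reverse_singleton, List.singleton_append,
      List.sum_singleton]
    rw [returnPoly_cons]
    push_cast
    rw [add_sub_cancel_right]
    ring

theorem weight_reverse (w : Word) : weight w.reverse = weight w := by
  show (w.toList.reverse.map _).sum = _
  rw [List.map_reverse, List.sum_reverse, weight]

theorem compWord_blocks {n : ℕ} (e : Composition n) :
    ((compWord e).toList).map (fun i : ℕ+ => (i : ℕ)) = e.blocks := by
  show (e.blocks.pmap (fun i h => Nat.toPNat i h) fun _ h => e.blocks_pos h).map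
    (fun i : ℕ+ => (i : ℕ)) = e.blocks
  rw [List.map_pmap]
  exact (List.pmap_eq_map (f := fun i : ℕ => i) _).trans (List.map_id' _)

theorem coeff_firstReturn (g : SeriesGroup) (n : ℕ) :
    coeff (n + 1) (firstReturn g).1 = transferCoeff n 0 g := by
  rw [firstReturn, PowerSeries.coeff_mk, transferCoeff]
  simp only [← compWord_blocks]
  rw [sum_compWord n fun w => returnPoly (w.toList.map fun i : ℕ+ => (i : ℕ)) n *
    wordCoeff w.reverse (g : NCSeries)]
  refine Finset.sum_nbij' FreeMonoid.reverse FreeMonoid.reverse ?_ ?_ ?_ ?_ ?_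
  · intro w hw
    rwa [mem_wordsOfWeight, weight_reverse, ← mem_wordsOfWeight]
  · intro w hw
    rwa [mem_wordsOfWeight, weight_reverse, ← mem_wordsOfWeight]
  · intro w _
    exact FreeMonoid.reverse_reverse
  · intro w _
    exact FreeMonoid.reverse_reverse
  · intro w hw
    congr 1
    rw [← returnPoly_reverse]
    have h1 : (w.reverse.toList.map fun i : ℕ+ => (i : ℕ)).reverse =
        w.toList.map fun i : ℕ+ => (i : ℕ) := by
      show (w.toList.reverse.map _).reverse = _
      rw [List.map_reverse, List.reverse_reverse]
    have h2 : (w.reverse.toList.map fun i : ℕ+ => (i : ℕ)).sum = n := by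
      rw [← mem_wordsOfWeight.1 hw]
      exact weight_reverse w
    rw [h1, h2]

theorem ReturnSeries.ext {s s' : ReturnSeries} (h : ∀ n, coeff (n + 1) s.1 = coeff (n + 1) s'.1) :
    s = s' := by
  apply Subtype.ext
  ext1 n
  rcases n with _ | n
  · rw [s.2.1, s'.2.1]
  · exact h n

theorem firstReturn_eq_iff {g h : SeriesGroup} :
    firstReturn g = firstReturn h ↔ ∀ n, transferCoeff n 0 g = transferCoeff n 0 h := by
  simp_rw [← coeff_firstReturn]
  exact ⟨fun e n => by rw [e], ReturnSeries.ext⟩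

theorem firstReturn_one : firstReturn 1 = ReturnSeries.identity := by
  refine ReturnSeries.ext fun n => ?_
  have h := coeff_PsiG 1 n 0 (PowerSeries.X ^ (0 + n))
  rw [PowerSeries.coeff_X_pow_self, mul_one, map_one] at h
  rw [coeff_firstReturn, ← h, PowerSeries.coeff_one]
  show _ = coeff (n + 1) (PowerSeries.X : PowerSeries ℂ)
  rw [PowerSeries.coeff_X]
  split_ifs with h1 h2 h2
  · subst h1
    simp
  · omega
  · omega
  · simp

theorem firstReturn_eq_of_PsiG_eq {g h : SeriesGroup} (e : PsiG g = PsiG h) :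
    firstReturn g = firstReturn h :=
  firstReturn_eq_iff.2 fun n => PsiG_eq_iff.1 e n 0

theorem continuous_coeff_returnSeries (n : ℕ) : Continuous fun s : ReturnSeries => coeff n s.1 :=
  continuous_pi_iff.1 (continuous_induced_dom (f := fun (s : ReturnSeries) (n : ℕ) =>
    coeff n s.1)) n

theorem continuous_firstReturn : Continuous firstReturn := by
  rw [continuous_induced_rng, continuous_pi_iff]
  intro n
  rcases n with _ | n
  · simp only [Function.comp_apply, (firstReturn _).2.1]
    exact continuous_const
  · simp only [Function.comp_apply, coeff_firstReturn]
    exact continuous_transferCoeff n 0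

/-! ### Logarithms -/

theorem coeff_Psi (f : NCSeries) (n : ℕ) : coeff n (Psi f) = psi (coeff n f) :=
  PowerSeries.coeff_map _ _ _

theorem Psi_logSeries (f : NCSeries) : Psi (logSeries f) = logSeries (Psi f) := by
  ext1 n
  rw [coeff_Psi, logSeries, logSeries, PowerSeries.coeff_mk, PowerSeries.coeff_mk, map_neg, map_sum]
  congr 1
  refine Finset.sum_congr rfl fun k _ => ?_
  rw [map_smul, ← coeff_Psi, map_pow, map_sub, map_one]

theorem logSeries_PsiG_expG (c : ℕ+ → ℂ) :
    logSeries (PsiG (expG (linearElement c))) = Psi (linearElement c : NCSeries) := by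
  show logSeries (Psi (expSeries (linearElement c : NCSeries))) = _
  rw [← Psi_logSeries, logSeries_expSeries (linearElement c).2.2]

theorem liftA_Psi_linearElement (c : ℕ+ → ℂ) :
    liftA (Psi (linearElement c : NCSeries)) = linearElement c := by
  have key : Psi (linearElement c : NCSeries) =
      mk fun n => if h : 0 < n then c ⟨n, h⟩ • (opD * opL ^ (n - 1)) else 0 := by
    ext1 n
    rw [coeff_Psi, PowerSeries.coeff_mk]
    show psi (coeff n (mk _)) = _
    rw [PowerSeries.coeff_mk]
    split_ifs with h
    · refine (MonoidAlgebra.lift_single _ _ _).trans ?_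
      exact congrArg (c ⟨n, h⟩ • ·) (FreeMonoid.lift_eval_of
        (fun i : ℕ+ => opD * opL ^ ((i : ℕ) - 1)) ⟨n, h⟩)
    · exact map_zero _
  rw [key, liftA_eq]

/-- Shows that `Ψ` is injective on the exponentials of `L`, with an explicit inverse. Both `T_PL`
and `s(a, b)` are computed from this. -/
theorem liftA_logSeries_PsiG_expG (c : ℕ+ → ℂ) :
    liftA (logSeries (PsiG (expG (linearElement c)))) = linearElement c := by
  rw [logSeries_PsiG_expG, liftA_Psi_linearElement]

theorem sL_eq (a b : seriesLie) :
    sL a b = liftA (logSeries (PsiG (expG a * expG b))) := by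
  rw [sL, Psi_logSeries]
  rfl

theorem expG_neg (h : seriesLie) : expG (-h) = (expG h)⁻¹ := by
  refine (inv_eq_of_mul_eq_one_right ?_).symm
  exact Subtype.ext (expSeries_mul_expSeries_neg h.2.2)

theorem expG_linearElement_zero : expG (linearElement 0) = 1 := by
  refine SeriesGroup.ext_wordCoeff fun w => ?_
  rcases word_cases w with rfl | ⟨i, w, rfl⟩
  · rw [wordCoeff_one_eq, wordCoeff_one_eq]
  · rw [wordCoeff_expG, wordProd_consWord, Pi.zero_apply, zero_mul, mul_zero, wordCoeff,
      SeriesGroup.coe_one, PowerSeries.coeff_one,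
      if_neg fun h => consWord_ne_one i w (weight_eq_zero.1 h)]
    rfl

/-! ### Multiplicative elements -/

/-- Elements `g` for which the transpose of `Ψ(g)` is multiplicative. -/
def IsMultiplicative (g : SeriesGroup) : Prop :=
  ∀ n j k, transferCoeff n (j + k + 1) g =
    ∑ p ∈ Finset.HasAntidiagonal.antidiagonal n, transferCoeff p.1 j g * transferCoeff p.2 k g

theorem isClosed_isMultiplicative : IsClosed {g | IsMultiplicative g} := by
  simp only [IsMultiplicative, Set.ofPred_forall]
  refine isClosed_iInter fun n => isClosed_iInter fun j => isClosed_iInter fun k => ?_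
  exact isClosed_eq (continuous_transferCoeff _ _) (continuous_finsetSum _ fun p _ =>
    (continuous_transferCoeff _ _).mul (continuous_transferCoeff _ _))

/-- The relation with `j = 0` expresses row `k + 1` through rows `0` and `k`, so row `0`, which is
`P̂`, determines all of `Ψ`. -/
theorem IsMultiplicative.PsiG_eq {g h : SeriesGroup} (hg : IsMultiplicative g)
    (hh : IsMultiplicative h) (e : firstReturn g = firstReturn h) : PsiG g = PsiG h := by
  rw [firstReturn_eq_iff] at e
  refine PsiG_eq_iff.2 fun n k => ?_
  induction k generalizing n with
  | zero => exact e n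
  | succ k ih =>
    have h1 := hg n 0 k
    have h2 := hh n 0 k
    rw [zero_add] at h1 h2
    rw [h1, h2]
    exact Finset.sum_congr rfl fun p _ => by rw [e, ih]

theorem isMultiplicative_one : IsMultiplicative 1 := by
  have h : ∀ n k, transferCoeff n k 1 = if n = 0 then 1 else 0 := by
    intro n k
    have h := coeff_PsiG 1 n k (PowerSeries.X ^ (k + n))
    rw [PowerSeries.coeff_X_pow_self, mul_one, map_one, PowerSeries.coeff_one] at h
    rw [← h]
    split_ifs with h1
    · subst h1
      rw [Module.End.one_apply, add_zero, PowerSeries.coeff_X_pow_self]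
    · simp
  intro n j k
  simp_rw [h]
  rcases n with _ | n
  · simp
  · rw [if_neg (Nat.succ_ne_zero n), Finset.sum_eq_zero]
    intro p hp
    rw [Finset.HasAntidiagonal.mem_antidiagonal] at hp
    by_cases h1 : p.1 = 0
    · rw [if_neg (show p.2 ≠ 0 by omega), mul_zero]
    · rw [if_neg h1, zero_mul]

/-- The flow of a constant vector field, started at `h`. -/
def linearFlow (c : ℕ+ → ℂ) (h : SeriesGroup) (x : ℂ) : SeriesGroup :=
  expG (linearElement (x • c)) * h

theorem wordProd_smul (x : ℂ) (c : ℕ+ → ℂ) (w : Word) :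
    wordProd (x • c) w = x ^ w.length * wordProd c w := by
  induction w using word_induction with
  | one => simp
  | cons i w ih =>
    rw [wordProd_consWord, wordProd_consWord, length_consWord, ih, Pi.smul_apply, smul_eq_mul]
    ring

theorem wordCoeff_linearFlow (c : ℕ+ → ℂ) (h : SeriesGroup) (x : ℂ) (w : Word) :
    wordCoeff w (linearFlow c h x : NCSeries) = ∑ p ∈ splits w,
      (p.1.length.factorial : ℂ)⁻¹ * (x ^ p.1.length * wordProd c p.1) *
        wordCoeff p.2 (h : NCSeries) := by
  rw [linearFlow, wordCoeff_mul_group]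
  simp_rw [wordCoeff_expG, wordProd_smul]

/-- This is the equation `F' = (∑ c_i X_i tⁱ) F` coefficientwise: multiplying by the field on the
left strips the first letter. Working with polynomials in a complex time `x` avoids integrals. -/
theorem hasDerivAt_wordCoeff_linearFlow (c : ℕ+ → ℂ) (h : SeriesGroup) (i : ℕ+) (w : Word)
    (x : ℂ) :
    HasDerivAt (fun x => wordCoeff (consWord i w) (linearFlow c h x : NCSeries))
      (c i * wordCoeff w (linearFlow c h x : NCSeries)) x := by
  simp_rw [wordCoeff_linearFlow, sum_splits_consWord, Finset.mul_sum]
  rw [← zero_add (∑ p ∈ splits w, _)]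
  refine HasDerivAt.add ?_ (HasDerivAt.fun_sum fun p _ => ?_)
  · simp only [FreeMonoid.length_one, pow_zero]
    exact hasDerivAt_const _ _
  · simp only [length_consWord, wordProd_consWord]
    have h1 := (((hasDerivAt_pow (p.1.length + 1) x).mul_const (c i * wordProd c p.1)).const_mul
      ((p.1.length + 1).factorial : ℂ)⁻¹).mul_const (wordCoeff p.2 (h : NCSeries))
    refine h1.congr_deriv ?_
    rw [Nat.factorial_succ, Nat.add_sub_cancel]
    have h2 : ((p.1.length + 1 : ℕ) : ℂ) ≠ 0 := Nat.cast_ne_zero.2 (Nat.succ_ne_zero _)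
    have h3 : (p.1.length.factorial : ℂ) ≠ 0 := Nat.cast_ne_zero.2 (Nat.factorial_ne_zero _)
    rw [Nat.cast_mul]
    field_simp

theorem hasDerivAt_transferCoeff_linearFlow (c : ℕ+ → ℂ) (h : SeriesGroup) (n k : ℕ) (x : ℂ) :
    HasDerivAt (fun x => transferCoeff n k (linearFlow c h x))
      (∑ p ∈ Finset.HasAntidiagonal.antidiagonal n, if 0 < p.1 then
        c p.1.toPNat' * (k + 1) * transferCoeff p.2 (k + p.1) (linearFlow c h x) else 0) x := by
  rcases eq_or_ne n 0 with rfl | hn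
  · simp_rw [transferCoeff_zero]
    simpa using hasDerivAt_const x (1 : ℂ)
  · simp_rw [transferCoeff, sum_wordsOfWeight hn]
    refine HasDerivAt.fun_sum fun p _ => ?_
    split_ifs with hp
    · rw [Finset.mul_sum]
      refine HasDerivAt.fun_sum fun w _ => ?_
      refine ((hasDerivAt_wordCoeff_linearFlow c h _ w x).const_mul _).congr_deriv ?_
      rw [shiftCoeff_consWord, Nat.toPNat'_coe, if_pos hp]
      ring
    · exact hasDerivAt_const _ _

/-- Both sides run over triples `a + b + d = n`. This and the next identity bring the letter removed
by differentiation to the front in each half of the Leibniz rule. -/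
theorem sum_antidiagonal_assoc {M : Type*} [AddCommMonoid M] (n : ℕ) (f : ℕ → ℕ → ℕ → M) :
    ∑ p ∈ Finset.HasAntidiagonal.antidiagonal n, ∑ q ∈ Finset.HasAntidiagonal.antidiagonal p.1,
      f q.1 q.2 p.2 = ∑ p ∈ Finset.HasAntidiagonal.antidiagonal n,
        ∑ q ∈ Finset.HasAntidiagonal.antidiagonal p.2, f p.1 q.1 q.2 := by
  rw [Finset.sum_sigma', Finset.sum_sigma']
  refine Finset.sum_nbij' (fun x => ⟨(x.2.1, x.2.2 + x.1.2), (x.2.2, x.1.2)⟩)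
    (fun x => ⟨(x.1.1 + x.2.1, x.2.2), (x.1.1, x.2.1)⟩) ?_ ?_ ?_ ?_ ?_
  · rintro ⟨⟨a, b⟩, ⟨d, e⟩⟩ hx
    simp only [Finset.mem_sigma, Finset.HasAntidiagonal.mem_antidiagonal] at hx ⊢
    exact ⟨by omega, trivial⟩
  · rintro ⟨⟨a, b⟩, ⟨d, e⟩⟩ hx
    simp only [Finset.mem_sigma, Finset.HasAntidiagonal.mem_antidiagonal] at hx ⊢
    exact ⟨by omega, trivial⟩
  · rintro ⟨⟨a, b⟩, ⟨d, e⟩⟩ hx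
    simp only [Finset.mem_sigma, Finset.HasAntidiagonal.mem_antidiagonal] at hx
    simp only [hx.2]
  · rintro ⟨⟨a, b⟩, ⟨d, e⟩⟩ hx
    simp only [Finset.mem_sigma, Finset.HasAntidiagonal.mem_antidiagonal] at hx
    simp only [hx.2]
  · intros
    rfl

theorem sum_antidiagonal_assoc' {M : Type*} [AddCommMonoid M] (n : ℕ) (f : ℕ → ℕ → ℕ → M) :
    ∑ p ∈ Finset.HasAntidiagonal.antidiagonal n, ∑ q ∈ Finset.HasAntidiagonal.antidiagonal p.2,
      f p.1 q.1 q.2 = ∑ p ∈ Finset.HasAntidiagonal.antidiagonal n,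
        ∑ q ∈ Finset.HasAntidiagonal.antidiagonal p.2, f q.1 p.1 q.2 := by
  rw [← sum_antidiagonal_assoc, ← sum_antidiagonal_assoc n fun a b d => f b a d]
  refine Finset.sum_congr rfl fun p _ => ?_
  rw [← Finset.Nat.sum_antidiagonal_swap]
  rfl

theorem IsMultiplicative.linearFlow (c : ℕ+ → ℂ) {h : SeriesGroup} (hh : IsMultiplicative h)
    (x : ℂ) : IsMultiplicative (linearFlow c h x) := by
  have h0 : CenterProblem.linearFlow c h 0 = h := by
    rw [CenterProblem.linearFlow, zero_smul, expG_linearElement_zero, one_mul]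
  intro n
  induction n using Nat.strong_induction_on generalizing x with
  | _ n ih =>
    intro j k
    set T : ℕ → ℕ → ℂ → ℂ := fun n k x => transferCoeff n k (CenterProblem.linearFlow c h x) with hT
    -- The defect of multiplicativity in degree `n` has zero derivative, because differentiation
    -- removes a letter of positive weight and leaves lower degrees, where the relation is known.
    have hd : ∀ y, HasDerivAt (fun y => T n (j + k + 1) y -
        ∑ p ∈ Finset.HasAntidiagonal.antidiagonal n, T p.1 j y * T p.2 k y) 0 y := by
      intro y
      have h1 := (hasDerivAt_transferCoeff_linearFlow c h n (j + k + 1) y).sub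
        (HasDerivAt.fun_sum (u := Finset.HasAntidiagonal.antidiagonal n) fun p _ =>
          (hasDerivAt_transferCoeff_linearFlow c h p.1 j y).mul
          (hasDerivAt_transferCoeff_linearFlow c h p.2 k y))
      refine h1.congr_deriv ?_
      rw [Finset.sum_add_distrib]
      simp_rw [Finset.sum_mul, Finset.mul_sum]
      rw [sum_antidiagonal_assoc n fun a b d => (if 0 < a then c a.toPNat' * (j + 1) *
        T b (j + a) y else 0) * T d k y, sum_antidiagonal_assoc' n fun a b d => T a j y *
        (if 0 < b then c b.toPNat' * (k + 1) * T d (k + b) y else 0), ← Finset.sum_add_distrib,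
        ← Finset.sum_sub_distrib]
      refine Finset.sum_eq_zero fun p hp => ?_
      rw [Finset.HasAntidiagonal.mem_antidiagonal] at hp
      split_ifs with hp1
      -- Both convolutions equal the same entry, in row `j + k + 1 + p.1`; their prefactors `j + 1`
      -- and `k + 1` add up to `(j + k + 1) + 1`, the prefactor of the remaining term.
      · have e1 := ih p.2 (by omega) y (j + p.1) k
        have e2 := ih p.2 (by omega) y j (k + p.1)
        rw [show j + p.1 + k + 1 = j + k + 1 + p.1 by ring] at e1
        rw [show j + (k + p.1) + 1 = j + k + 1 + p.1 by ring] at e2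
        simp_rw [mul_assoc (c p.1.toPNat' * _), mul_left_comm (T _ j y), ← Finset.mul_sum]
        simp only [hT]
        rw [← e1, ← e2]
        push_cast
        ring
      · simp
    have hc := is_const_of_deriv_eq_zero (fun y => (hd y).differentiableAt)
      (fun y => (hd y).deriv) x 0
    simp only [hT, h0] at hc
    rw [hh n j k, sub_self] at hc
    exact sub_eq_zero.1 hc

theorem IsMultiplicative.expG_mul (c : ℕ+ → ℂ) {h : SeriesGroup} (hh : IsMultiplicative h) :
    IsMultiplicative (expG (linearElement c) * h) := by
  have := hh.linearFlow c 1
  rwa [CenterProblem.linearFlow, one_smul] at this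

/-- Left multiplication by generators suffices, inverses being exponentials `e^(-h)` again. -/
theorem isMultiplicative_of_mem_PL {g : SeriesGroup} (hg : g ∈ PL) : IsMultiplicative g := by
  induction hg using Subgroup.closure_induction_left with
  | one => exact isMultiplicative_one
  | mul_left x hx y _ hy =>
    obtain ⟨_, ⟨c, rfl⟩, rfl⟩ := hx
    exact hy.expG_mul c
  | inv_mul_cancel x hx y _ hy =>
    obtain ⟨_, ⟨c, rfl⟩, rfl⟩ := hx
    rw [← expG_neg, ← linearElement_neg]
    exact hy.expG_mul (-c)

/-! ### Iterated integrals -/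

/-- The iterated integral `∫_{x₀ ≤ s_k ≤ ⋯ ≤ s₁ ≤ x} b_{i₁}(s₁) ⋯ b_{i_k}(s_k)`. -/
def iterInt (b : ℕ+ → ℝ → ℂ) (x₀ : ℝ) : List ℕ+ → ℝ → ℂ
  | [], _ => 1
  | i :: w, x => ∫ s in x₀..x, b i s * iterInt b x₀ w s

theorem iterInt_consWord (b : ℕ+ → ℝ → ℂ) (x₀ : ℝ) (i : ℕ+) (w : Word) (x : ℝ) :
    iterInt b x₀ (consWord i w).toList x = ∫ s in x₀..x, b i s * iterInt b x₀ w.toList s := rfl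

/-- The series of the iterated integrals from `x₀` to `x`. -/
def flow (b : ℕ+ → ℝ → ℂ) (x₀ x : ℝ) : SeriesGroup :=
  ⟨ofWordCoeff fun w => iterInt b x₀ w.toList x, ofWordCoeff_mem _, by
    rw [← PowerSeries.coeff_zero_eq_constantCoeff_apply, ofWordCoeff, PowerSeries.coeff_mk]
    have h : Fintype.card (Composition 0) = 1 := by simp [composition_card]
    simp [compWord_zero, iterInt, MonoidAlgebra.one_def, h]⟩

theorem wordCoeff_flow (b : ℕ+ → ℝ → ℂ) (x₀ x : ℝ) (w : Word) :
    wordCoeff w (flow b x₀ x : NCSeries) = iterInt b x₀ w.toList x :=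
  wordCoeff_ofWordCoeff _ _

/-- Integrability of all components on all bounded intervals. -/
def LocIntegrable (b : ℕ+ → ℝ → ℂ) : Prop := ∀ i x y, IntervalIntegrable (b i) volume x y

section

variable {b : ℕ+ → ℝ → ℂ}

theorem LocIntegrable.continuous_iterInt (hb : LocIntegrable b) (x₀ : ℝ) (l : List ℕ+) :
    Continuous (iterInt b x₀ l) := by
  induction l with
  | nil => exact continuous_const
  | cons i l ih =>
    exact intervalIntegral.continuous_primitive
      (fun x y => (hb i x y).mul_continuousOn ih.continuousOn) x₀

theorem LocIntegrable.intervalIntegrable_mul (hb : LocIntegrable b) (i : ℕ+) (x₀ : ℝ) (l : List ℕ+)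
    (x y : ℝ) : IntervalIntegrable (fun s => b i s * iterInt b x₀ l s) volume x y :=
  (hb i x y).mul_continuousOn (hb.continuous_iterInt x₀ l).continuousOn

/-- Chen's identity. -/
theorem LocIntegrable.iterInt_eq_sum_splits (hb : LocIntegrable b) (x₀ x₁ x₂ : ℝ) (w : Word) :
    iterInt b x₀ w.toList x₂ =
      ∑ p ∈ splits w, iterInt b x₁ p.1.toList x₂ * iterInt b x₀ p.2.toList x₁ := by
  induction w using word_induction generalizing x₂ with
  | one =>
    rw [sum_splits_one]
    exact (one_mul (1 : ℂ)).symm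
  -- The outer integral is cut at `x₁`. The piece up to `x₁` is the term with empty first factor; on
  -- the other piece the induction hypothesis applies under the integral.
  | cons i w ih =>
    rw [sum_splits_consWord, iterInt_consWord, ← intervalIntegral.integral_add_adjacent_intervals
      (hb.intervalIntegrable_mul i x₀ _ x₀ x₁) (hb.intervalIntegrable_mul i x₀ _ x₁ x₂)]
    congr 1
    · exact (one_mul _).symm
    · simp_rw [ih, Finset.mul_sum, ← mul_assoc]
      rw [intervalIntegral.integral_finsetSum fun p _ =>
        (hb.intervalIntegrable_mul i x₁ _ x₁ x₂).mul_const _]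
      exact Finset.sum_congr rfl fun p _ => intervalIntegral.integral_mul_const _ _

theorem LocIntegrable.flow_mul (hb : LocIntegrable b) (x₀ x₁ x₂ : ℝ) :
    flow b x₁ x₂ * flow b x₀ x₁ = flow b x₀ x₂ := by
  refine SeriesGroup.ext_wordCoeff fun w => ?_
  rw [wordCoeff_mul_group, wordCoeff_flow, hb.iterInt_eq_sum_splits x₀ x₁]
  simp_rw [wordCoeff_flow]

theorem flow_self (b : ℕ+ → ℝ → ℂ) (x : ℝ) : flow b x x = 1 := by
  refine SeriesGroup.ext_wordCoeff fun w => ?_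
  rcases word_cases w with rfl | ⟨i, w, rfl⟩
  · rw [wordCoeff_one_eq, wordCoeff_one_eq]
  · rw [wordCoeff_flow, iterInt_consWord, intervalIntegral.integral_same, wordCoeff,
      SeriesGroup.coe_one, PowerSeries.coeff_one,
      if_neg fun h => consWord_ne_one i w (weight_eq_zero.1 h)]
    rfl

theorem iterInt_of_const {c : ℕ+ → ℂ} {x₀ x₁ : ℝ} (h : ∀ i, ∀ s ∈ Set.Ioc x₀ x₁, b i s = c i)
    (w : Word) {x : ℝ} (hx : x ∈ Set.Icc x₀ x₁) :
    iterInt b x₀ w.toList x =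
      (w.length.factorial : ℂ)⁻¹ * (((x - x₀ : ℝ) : ℂ) ^ w.length * wordProd c w) := by
  induction w using word_induction generalizing x with
  | one => simp [iterInt]
  | cons i w ih =>
    have hd : ∀ s : ℝ, HasDerivAt (fun s : ℝ => ((consWord i w).length.factorial : ℂ)⁻¹ *
        (((s - x₀ : ℝ) : ℂ) ^ (consWord i w).length * wordProd c (consWord i w)))
        (c i * ((w.length.factorial : ℂ)⁻¹ * (((s - x₀ : ℝ) : ℂ) ^ w.length * wordProd c w))) s := by
      intro s
      rw [length_consWord, wordProd_consWord]
      have h1 := ((((hasDerivAt_id s).sub_const x₀).ofReal_comp.pow (w.length + 1)).mul_const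
        (c i * wordProd c w)).const_mul ((w.length + 1).factorial : ℂ)⁻¹
      refine h1.congr_deriv ?_
      rw [Nat.factorial_succ, Nat.add_sub_cancel]
      have h2 : ((w.length + 1 : ℕ) : ℂ) ≠ 0 := Nat.cast_ne_zero.2 (Nat.succ_ne_zero _)
      have h3 : (w.length.factorial : ℂ) ≠ 0 := Nat.cast_ne_zero.2 (Nat.factorial_ne_zero _)
      rw [Nat.cast_mul]
      field_simp
      simp only [Complex.ofReal_sub, id, Complex.ofReal_one]
      ring
    have hint : ∫ s in x₀..x, b i s * iterInt b x₀ w.toList s = ∫ s in x₀..x,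
        c i * ((w.length.factorial : ℂ)⁻¹ *
          (((s - x₀ : ℝ) : ℂ) ^ w.length * wordProd c w)) := by
      rw [intervalIntegral.integral_of_le hx.1, intervalIntegral.integral_of_le hx.1]
      refine setIntegral_congr_fun measurableSet_Ioc fun s hs => ?_
      have hs2 : s ∈ Set.Ioc x₀ x₁ := ⟨hs.1, hs.2.trans hx.2⟩
      rw [h i s hs2, ih ⟨hs2.1.le, hs2.2⟩]
    rw [iterInt_consWord, hint, intervalIntegral.integral_eq_sub_of_hasDerivAt (fun s _ => hd s)]
    · rw [sub_self, length_consWord]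
      simp
    · exact Continuous.intervalIntegrable (by fun_prop) _ _

theorem flow_of_const {c : ℕ+ → ℂ} {x₀ x₁ : ℝ} (hx : x₀ ≤ x₁)
    (h : ∀ i, ∀ s ∈ Set.Ioc x₀ x₁, b i s = c i) :
    flow b x₀ x₁ = expG (linearElement (((x₁ - x₀ : ℝ) : ℂ) • c)) := by
  refine SeriesGroup.ext_wordCoeff fun w => ?_
  rw [wordCoeff_flow, iterInt_of_const h w ⟨hx, le_rfl⟩, wordCoeff_expG, wordProd_smul]

theorem expG_linearElement_mem_PL (c : ℕ+ → ℂ) : expG (linearElement c) ∈ PL :=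
  Subgroup.subset_closure ⟨_, ⟨c, rfl⟩, rfl⟩

/-- The flow of a step function is piecewise linear. -/
theorem LocIntegrable.flow_mem_PL (hb : LocIntegrable b) {δ : ℝ} (hδ : 0 ≤ δ)
    {c : ℕ → ℕ+ → ℂ} (h : ∀ (j : ℕ) i, ∀ s ∈ Set.Ioc (j * δ) ((j + 1 : ℕ) * δ), b i s = c j i)
    (j : ℕ) : flow b 0 (j * δ) ∈ PL := by
  induction j with
  | zero =>
    rw [Nat.cast_zero, zero_mul, flow_self]
    exact one_mem _
  | succ j ih =>
    rw [← hb.flow_mul 0 (j * δ)]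
    refine mul_mem ?_ ih
    rw [flow_of_const _ (h j)]
    · exact expG_linearElement_mem_PL _
    · gcongr
      exact Nat.le_succ j

/-- Iterated integrals depend continuously on the components in `L¹`. The estimate has to be uniform
in the upper limit for the induction on the word to pass under the next integral. -/
theorem exists_iterInt_sub_le {ι : Type*} {l : Filter ι} {B : ι → ℕ+ → ℝ → ℂ}
    (hb : LocIntegrable b) (hB : ∀ n, LocIntegrable (B n)) {T : ℝ}
    (h : ∀ i, Filter.Tendsto (fun n => ∫ s in (0 : ℝ)..T, ‖B n i s - b i s‖) l (𝓝 0))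
    (w : List ℕ+) :
    ∃ u : ι → ℝ, Filter.Tendsto u l (𝓝 0) ∧ ∀ n, ∀ x ∈ Set.Icc 0 T,
      ‖iterInt (B n) 0 w x - iterInt b 0 w x‖ ≤ u n := by
  induction w with
  | nil => exact ⟨fun _ => 0, tendsto_const_nhds, fun n x _ => by simp [iterInt]⟩
  | cons i w ih =>
    obtain ⟨u, hu, hle⟩ := ih
    obtain ⟨C, hC⟩ := isCompact_Icc.exists_bound_of_continuousOn
      (hb.continuous_iterInt 0 w).continuousOn (s := Set.Icc 0 T)
    refine ⟨fun n => (∫ s in (0 : ℝ)..T, ‖B n i s - b i s‖) * (C + u n) +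
      (∫ s in (0 : ℝ)..T, ‖b i s‖) * u n, ?_, ?_⟩
    · have h1 := ((h i).mul (hu.const_add C)).add (hu.const_mul (∫ s in (0 : ℝ)..T, ‖b i s‖))
      simpa using h1
    · intro n x hx
      have hsub : ∀ y z, IntervalIntegrable (fun s => B n i s - b i s) volume y z :=
        fun y z => (hB n i y z).sub (hb i y z)
      have hmono : ∀ f : ℝ → ℂ, (∀ y z, IntervalIntegrable f volume y z) →
          ∫ s in (0 : ℝ)..x, ‖f s‖ ≤ ∫ s in (0 : ℝ)..T, ‖f s‖ := fun f hf =>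
        intervalIntegral.integral_mono_interval le_rfl hx.1 hx.2
          (Filter.Eventually.of_forall fun s => norm_nonneg _) (hf 0 T).norm
      have hmem : ∀ s ∈ Set.Icc 0 x, s ∈ Set.Icc 0 T := fun s hs => ⟨hs.1, hs.2.trans hx.2⟩
      have hu0 : 0 ≤ u n := (norm_nonneg _).trans (hle n x hx)
      have hC0 : 0 ≤ C := (norm_nonneg _).trans (hC x hx)
      have hdiff : IntervalIntegrable (fun s => b i s * (iterInt (B n) 0 w s - iterInt b 0 w s))
          volume 0 x := (hb i 0 x).mul_continuousOn (((hB n).continuous_iterInt 0 w).sub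
            (hb.continuous_iterInt 0 w)).continuousOn
      -- The difference of products is telescoped: the first part is small in `L¹` against a factor
      -- bounded by `C + u n`, the second is integrable against a factor bounded by `u n`.
      have key : iterInt (B n) 0 (i :: w) x - iterInt b 0 (i :: w) x =
          (∫ s in (0 : ℝ)..x, (B n i s - b i s) * iterInt (B n) 0 w s) +
            ∫ s in (0 : ℝ)..x, b i s * (iterInt (B n) 0 w s - iterInt b 0 w s) := by
        rw [iterInt, iterInt, ← intervalIntegral.integral_sub
          ((hB n).intervalIntegrable_mul i 0 w 0 x) (hb.intervalIntegrable_mul i 0 w 0 x),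
          ← intervalIntegral.integral_add
          ((hsub 0 x).mul_continuousOn ((hB n).continuous_iterInt 0 w).continuousOn) hdiff]
        congr 1
        funext s
        ring
      have hbound : ∀ (f g : ℝ → ℂ) (K : ℝ), 0 ≤ K → (∀ y z, IntervalIntegrable f volume y z) →
          (∀ s ∈ Set.Icc 0 T, ‖g s‖ ≤ K) →
          ‖∫ s in (0 : ℝ)..x, f s * g s‖ ≤ (∫ s in (0 : ℝ)..T, ‖f s‖) * K := by
        intro f g K hK hf hg
        refine (intervalIntegral.norm_integral_le_of_norm_le hx.1 (g := fun s => ‖f s‖ * K)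
          (Filter.Eventually.of_forall fun s hs => ?_) ((hf 0 x).norm.mul_const K)).trans ?_
        · rw [norm_mul]
          exact mul_le_mul_of_nonneg_left (hg s (hmem s ⟨hs.1.le, hs.2⟩)) (norm_nonneg _)
        · rw [intervalIntegral.integral_mul_const]
          exact mul_le_mul_of_nonneg_right (hmono f hf) hK
      rw [key]
      refine (norm_add_le _ _).trans (add_le_add ?_ ?_)
      · refine hbound _ _ _ (add_nonneg hC0 hu0) hsub fun s hs => ?_
        have h1 := norm_add_le (iterInt b 0 w s) (iterInt (B n) 0 w s - iterInt b 0 w s)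
        rw [add_sub_cancel] at h1
        exact h1.trans (add_le_add (hC s hs) (hle n s hs))
      · exact hbound _ _ _ hu0 (hb i) fun s hs => hle n s hs

theorem tendsto_flow {ι : Type*} {l : Filter ι} {B : ι → ℕ+ → ℝ → ℂ}
    (hb : LocIntegrable b) (hB : ∀ n, LocIntegrable (B n)) {T : ℝ} (hT : 0 ≤ T)
    (h : ∀ i, Filter.Tendsto (fun n => ∫ s in (0 : ℝ)..T, ‖B n i s - b i s‖) l (𝓝 0)) :
    Filter.Tendsto (fun n => flow (B n) 0 T) l (𝓝 (flow b 0 T)) := by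
  rw [nhds_induced, Filter.tendsto_comap_iff, tendsto_pi_nhds]
  intro w
  simp only [Function.comp_apply, wordCoeff_flow]
  obtain ⟨u, hu, hle⟩ := exists_iterInt_sub_le hb hB h w.toList
  rw [tendsto_iff_norm_sub_tendsto_zero]
  exact squeeze_zero (fun n => norm_nonneg _) (fun n => hle n T ⟨hT, le_rfl⟩) hu

/-! ### Density of piecewise linear paths -/

/-- The step function of mesh `δ` with the values of `g` at the right end points. -/
def stepFun (δ : ℝ) (g : ℕ+ → ℝ → ℂ) : ℕ+ → ℝ → ℂ := fun i s => g i (⌈s / δ⌉ * δ)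

/-- The ceiling is constant on intervals open on the left and closed on the right, which are also
the domains of interval integrals. -/
theorem stepFun_eq {δ : ℝ} (hδ : 0 < δ) (g : ℕ+ → ℝ → ℂ) (j : ℕ) (i : ℕ+) {s : ℝ}
    (hs : s ∈ Set.Ioc (j * δ) ((j + 1 : ℕ) * δ)) : stepFun δ g i s = g i ((j + 1 : ℕ) * δ) := by
  have h : ⌈s / δ⌉ = ((j + 1 : ℕ) : ℤ) := by
    rw [Int.ceil_eq_iff, lt_div_iff₀ hδ, div_le_iff₀ hδ]
    have := hs.1
    have := hs.2
    push_cast at *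
    constructor <;> linarith
  rw [stepFun, h, Int.cast_natCast]

theorem abs_ceil_mul_sub_le {δ : ℝ} (hδ : 0 < δ) (s : ℝ) : |⌈s / δ⌉ * δ - s| ≤ δ := by
  have h1 := Int.le_ceil (s / δ)
  have h2 := Int.ceil_lt_add_one (s / δ)
  have h3 : s / δ * δ = s := div_mul_cancel₀ s hδ.ne'
  rw [abs_le]
  constructor <;> nlinarith

theorem locIntegrable_of_bounded {g : ℕ+ → ℝ → ℂ} (hm : ∀ i, Measurable (g i))
    (hg : ∀ i, ∃ C, ∀ s, ‖g i s‖ ≤ C) : LocIntegrable g := by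
  intro i x y
  obtain ⟨C, hC⟩ := hg i
  exact (intervalIntegrable_const (c := C)).mono_fun (hm i).aestronglyMeasurable
    (Filter.Eventually.of_forall fun s => (hC s).trans (le_abs_self C))

theorem measurable_stepFun {δ : ℝ} {g : ℕ+ → ℝ → ℂ} (hg : ∀ i, Continuous (g i)) (i : ℕ+) :
    Measurable (stepFun δ g i) :=
  (hg i).measurable.comp ((measurable_from_top.comp (measurable_id.div_const δ).ceil).mul_const δ)

theorem flow_mem_closure_of_continuous {g : ℕ+ → ℝ → ℂ} (hg : ∀ i, Continuous (g i))
    (hC : ∀ i, ∃ C, ∀ s, ‖g i s‖ ≤ C) {T : ℝ} (hT : 0 < T) :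
    flow g 0 T ∈ PL.topologicalClosure := by
  have hint := locIntegrable_of_bounded (fun i => (hg i).measurable) hC
  -- With this mesh exactly `n + 1` steps end at `T`.
  set δ : ℕ → ℝ := fun n => T / (n + 1) with hδ
  have hδ0 : ∀ n, 0 < δ n := fun n => by positivity
  have hδt : Filter.Tendsto δ Filter.atTop (𝓝 0) := by
    have := (tendsto_one_div_add_atTop_nhds_zero_nat (𝕜 := ℝ)).const_mul T
    simpa [hδ, div_eq_mul_inv] using this
  have hstep : ∀ n, LocIntegrable (stepFun (δ n) g) := fun n =>
    locIntegrable_of_bounded (measurable_stepFun hg) fun i =>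
      ⟨_, fun s => (hC i).choose_spec _⟩
  have hpl : ∀ n, flow (stepFun (δ n) g) 0 T ∈ PL := by
    intro n
    have h := (hstep n).flow_mem_PL (hδ0 n).le (c := fun j i => g i ((j + 1 : ℕ) * δ n))
      (fun j i s hs => stepFun_eq (hδ0 n) g j i hs) (n + 1)
    have h2 : ((n + 1 : ℕ) : ℝ) * δ n = T := by
      simp only [hδ]
      push_cast
      field_simp
    rwa [h2] at h
  refine PL.isClosed_topologicalClosure.mem_of_tendsto (b := Filter.atTop) (tendsto_flow hint hstep hT.le ?_)
    (Filter.Eventually.of_forall fun n => PL.le_topologicalClosure (hpl n))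
  intro i
  obtain ⟨C, hCi⟩ := hC i
  suffices h0 : Filter.Tendsto (fun n => ∫ s in (0 : ℝ)..T, ‖stepFun (δ n) g i s - g i s‖) Filter.atTop
      (𝓝 (∫ s in (0 : ℝ)..T, (0 : ℝ))) by
    rwa [intervalIntegral.integral_zero] at h0
  refine intervalIntegral.tendsto_integral_filter_of_dominated_convergence
    (fun _ => C + C) (Filter.Eventually.of_forall fun n => ?_)
    (Filter.Eventually.of_forall fun n => ?_)
    intervalIntegrable_const (Filter.Eventually.of_forall fun s _ => ?_)
  · exact ((measurable_stepFun hg i).sub (hg i).measurable).norm.aestronglyMeasurable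
  · refine Filter.Eventually.of_forall fun s _ => ?_
    rw [norm_norm]
    exact (norm_sub_le _ _).trans (add_le_add (hCi _) (hCi _))
  · have h1 : Filter.Tendsto (fun n => (⌈s / δ n⌉ : ℝ) * δ n) Filter.atTop (𝓝 s) := by
      rw [tendsto_iff_norm_sub_tendsto_zero]
      exact squeeze_zero (fun n => norm_nonneg _)
        (fun n => abs_ceil_mul_sub_le (hδ0 n) s) hδt
    have h2 := ((((hg i).tendsto s).comp h1).sub_const (g i s)).norm
    rwa [sub_self, norm_zero] at h2

/-! ### Formal paths and the closure of `PL` -/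

theorem picardCoeff_eq_iterInt {T : ℝ} (a : ℕ+ → LInfty T) {b : ℕ+ → ℝ → ℂ}
    (h : ∀ i, a i =ᵐ[volume.restrict (Set.Icc 0 T)] b i) (w : List ℕ+) {x : ℝ}
    (hx : x ∈ Set.Icc 0 T) : picardCoeff a w x = iterInt b 0 w x := by
  induction w generalizing x with
  | nil => rfl
  | cons i w ih =>
    refine intervalIntegral.integral_congr_ae ?_
    filter_upwards [(ae_restrict_iff' measurableSet_Icc).1 (h i)] with s hs hsx
    rw [Set.uIoc_of_le hx.1] at hsx
    have hs2 : s ∈ Set.Icc 0 T := ⟨hsx.1.le, hsx.2.trans hx.2⟩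
    rw [hs hs2, ih hs2]

theorem monodromy_eq_flow {T : ℝ} (hT : 0 ≤ T) (a : ℕ+ → LInfty T) {b : ℕ+ → ℝ → ℂ}
    (h : ∀ i, a i =ᵐ[volume.restrict (Set.Icc 0 T)] b i) : monodromy a = flow b 0 T := by
  refine SeriesGroup.ext_wordCoeff fun w => ?_
  rw [wordCoeff_flow, ← picardCoeff_eq_iterInt a h w.toList ⟨hT, le_rfl⟩]
  exact wordCoeff_ofWordCoeff _ _

theorem monodromy_mem_closure {T : ℝ} (hT : 0 < T) (a : ℕ+ → LInfty T) :
    monodromy a ∈ PL.topologicalClosure := by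
  set μ := (volume : Measure ℝ).restrict (Set.Icc 0 T) with hμ
  -- Essentially bounded functions on `[0, T]` are integrable; extended by zero, they are locally
  -- integrable on the line.
  have ha : ∀ i, Integrable (a i) μ := fun i => (Lp.memLp (a i)).integrable le_top
  set b : ℕ+ → ℝ → ℂ := fun i => (Set.Icc 0 T).indicator (a i) with hbdef
  have hbi : ∀ i, Integrable (b i) volume := fun i =>
    (integrable_indicator_iff measurableSet_Icc).2 (ha i)
  have hb : LocIntegrable b := fun i x y => (hbi i).intervalIntegrable
  have hab : ∀ i, a i =ᵐ[μ] b i := fun i => (indicator_ae_eq_restrict measurableSet_Icc).symm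
  rw [monodromy_eq_flow hT.le a hab]
  -- Continuous functions of compact support are dense in `L¹`. The same error `1 / (n + 1)` is used
  -- for every letter.
  have hex := fun (n : ℕ) (i : ℕ+) =>
    (ha i).exists_hasCompactSupport_integral_sub_le (ε := 1 / ((n : ℝ) + 1)) (by positivity)
  choose g hgs hge hgc hgi using hex
  have hC : ∀ n i, ∃ C, ∀ s, ‖g n i s‖ ≤ C := fun n i =>
    (hgs n i).exists_bound_of_continuous (hgc n i)
  refine PL.isClosed_topologicalClosure.mem_of_tendsto (b := Filter.atTop) (f := fun n => flow (g n) 0 T)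
    (tendsto_flow hb (fun n => locIntegrable_of_bounded (fun i => (hgc n i).measurable) (hC n))
      hT.le ?_)
    (Filter.Eventually.of_forall fun n => flow_mem_closure_of_continuous (hgc n) (hC n) hT)
  intro i
  refine squeeze_zero (fun n => intervalIntegral.integral_nonneg hT.le fun _ _ => norm_nonneg _)
    (fun n => ?_) (tendsto_one_div_add_atTop_nhds_zero_nat (𝕜 := ℝ))
  refine le_trans (le_of_eq ?_) (hge n i)
  rw [intervalIntegral.integral_of_le hT.le, ← integral_Icc_eq_integral_Ioc]
  refine integral_congr_ae ?_
  filter_upwards [hab i] with s hs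
  rw [← hs, norm_sub_rev]

theorem formalPathGroup_le_closure {T : ℝ} (hT : 0 < T) :
    formalPathGroup T ≤ PL.topologicalClosure := by
  refine Subgroup.topologicalClosure_minimal _ ?_ PL.isClosed_topologicalClosure
  rw [pathGroup, Subgroup.closure_le]
  rintro _ ⟨a, _, rfl⟩
  exact monodromy_mem_closure hT a

/-- The truncation of a sequence. -/
def truncSeq (N : ℕ) (c : ℕ+ → ℂ) : ℕ+ → ℂ := fun i => if (i : ℕ) ≤ N then c i else 0

theorem tendsto_truncSeq (c : ℕ+ → ℂ) :
    Filter.Tendsto (fun N => truncSeq N c) Filter.atTop (𝓝 c) := by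
  rw [tendsto_pi_nhds]
  intro i
  refine tendsto_const_nhds.congr' ?_
  filter_upwards [Filter.eventually_ge_atTop (i : ℕ)] with N hN
  rw [truncSeq, if_pos hN]

/-- The path with constant coefficients `c_i / T`, run for time `T`, has this monodromy. Truncation
secures the growth condition defining `X`, which an arbitrary sequence may violate. -/
theorem expG_truncSeq_mem {T : ℝ} (hT : 0 < T) (N : ℕ) (c : ℕ+ → ℂ) :
    expG (linearElement (truncSeq N c)) ∈ pathGroup T := by
  refine Subgroup.subset_closure ⟨fun i => Lp.const ⊤ _ ((T : ℂ)⁻¹ * truncSeq N c i), ?_, ?_⟩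
  -- Beyond the truncation the values are `0^(1/i) = 0`, the exponent being nonzero, so the set of
  -- values is finite.
  · have hfin : (Set.range fun i : ℕ+ => ‖(Lp.const ⊤ (volume.restrict (Set.Icc 0 T))
        ((T : ℂ)⁻¹ * truncSeq N c i) : LInfty T)‖ ^ (1 / ((i : ℕ) : ℝ))).Finite := by
      refine Set.Finite.subset (((Set.finite_Iic N.succPNat).image fun i : ℕ+ =>
        ‖(Lp.const ⊤ (volume.restrict (Set.Icc 0 T))
        ((T : ℂ)⁻¹ * truncSeq N c i) : LInfty T)‖ ^ (1 / ((i : ℕ) : ℝ))).insert 0) ?_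
      rintro _ ⟨i, rfl⟩
      by_cases hi : i ≤ N.succPNat
      · exact Or.inr ⟨i, hi, rfl⟩
      · left
        have h2 : ¬ (i : ℕ) ≤ N := by
          intro h
          exact hi ((PNat.coe_le_coe _ _).1 (by rw [Nat.succPNat_coe]; omega))
        have hi0 : (1 / ((i : ℕ) : ℝ)) ≠ 0 := by
          have := i.pos
          positivity
        simp only [truncSeq, if_neg h2, mul_zero, map_zero, norm_zero]
        exact Real.zero_rpow hi0
    exact hfin.bddAbove
  · rw [monodromy_eq_flow hT.le _ (b := fun i _ => (T : ℂ)⁻¹ * truncSeq N c i)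
      (fun i => Lp.coeFn_const (p := ⊤) _ _),
      flow_of_const hT.le (c := fun i => (T : ℂ)⁻¹ * truncSeq N c i) (fun i s _ => rfl)]
    congr 2
    funext i
    have : (T : ℂ) ≠ 0 := Complex.ofReal_ne_zero.2 hT.ne'
    rw [Pi.smul_apply, smul_eq_mul, sub_zero, mul_inv_cancel_left₀ this]

theorem PL_le_formalPathGroup {T : ℝ} (hT : 0 < T) : PL ≤ formalPathGroup T := by
  rw [PL, Subgroup.closure_le]
  rintro _ ⟨_, ⟨c, rfl⟩, rfl⟩
  refine (pathGroup T).isClosed_topologicalClosure.mem_of_tendsto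
    ((continuous_expG_linearElement.tendsto c).comp (tendsto_truncSeq c))
    (Filter.Eventually.of_forall fun N =>
      (pathGroup T).le_topologicalClosure (expG_truncSeq_mem hT N c))

theorem isMultiplicative_of_mem_formalPathGroup {T : ℝ} (hT : 0 < T) {g : SeriesGroup}
    (hg : g ∈ formalPathGroup T) : IsMultiplicative g :=
  closure_minimal (fun _ => isMultiplicative_of_mem_PL) isClosed_isMultiplicative
    (formalPathGroup_le_closure hT hg)

end

/-! ### Solving `P̂(e^h) = s` -/

theorem wordProd_congr {c c' : ℕ+ → ℂ} {w : Word} (h : ∀ i ∈ w.toList, c i = c' i) :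
    wordProd c w = wordProd c' w := by
  rw [wordProd, wordProd, List.map_congr_left h]

theorem lt_weight_of_mem {w : Word} {i : ℕ+} (hi : i ∈ w.toList) (hw : w ≠ FreeMonoid.of i) :
    (i : ℕ) < weight w := by
  have hle : ∀ v : Word, i ∈ v.toList → (i : ℕ) ≤ weight v := fun v hv =>
    List.le_sum_of_mem (List.mem_map_of_mem hv)
  rcases word_cases w with rfl | ⟨j, w, rfl⟩
  · cases hi
  · rw [weight_consWord]
    rcases List.mem_cons.1 (show i ∈ j :: w.toList from hi) with rfl | hi
    · have h1 : weight w ≠ 0 := fun h0 => hw (by rw [weight_eq_zero.1 h0, consWord, mul_one])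
      omega
    · have h1 := hle w hi
      have h2 := j.pos
      omega

open Classical in
/-- The contribution of the words of more than one letter to `T n 0 e^h`. -/
def longWordSum (n : ℕ) (c : ℕ+ → ℂ) : ℂ :=
  ∑ w ∈ (wordsOfWeight n).erase (FreeMonoid.of n.toPNat'),
    shiftCoeff w.toList 0 * ((w.length.factorial : ℂ)⁻¹ * wordProd c w)

/-- In a word of weight `n` with more than one letter, each letter has weight below `n`. This makes
the system `P̂(e^h) = s` triangular. -/
theorem longWordSum_congr {n : ℕ} {c c' : ℕ+ → ℂ} (h : ∀ i : ℕ+, (i : ℕ) < n → c i = c' i) :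
    longWordSum n c = longWordSum n c' := by
  classical
  refine Finset.sum_congr rfl fun w hw => ?_
  rw [Finset.mem_erase, mem_wordsOfWeight] at hw
  rw [wordProd_congr fun i hi => h i ?_]
  rw [← hw.2]
  refine lt_weight_of_mem hi fun h2 => hw.1 ?_
  rw [← hw.2, h2, weight_of, PNat.coe_toPNat']

theorem continuous_longWordSum (n : ℕ) : Continuous (longWordSum n) :=
  continuous_finsetSum _ fun w _ =>
    continuous_const.mul (continuous_const.mul (continuous_wordProd w))

/-- The one-letter word enters with factor `0 + 1 = 1`, so `c i` can be solved for without division.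
-/
theorem transferCoeff_expG (i : ℕ+) (c : ℕ+ → ℂ) :
    transferCoeff i 0 (expG (linearElement c)) = c i + longWordSum i c := by
  classical
  rw [transferCoeff, ← Finset.add_sum_erase _ _
    (mem_wordsOfWeight.2 (weight_of i) : FreeMonoid.of i ∈ wordsOfWeight i), longWordSum,
    PNat.coe_toPNat']
  simp_rw [wordCoeff_expG]
  congr 1
  simp [shiftCoeff, wordProd]

/-- The recursive solution of `P̂(e^h) = s`. -/
def solveNat (s : ReturnSeries) (n : ℕ) : ℂ :=
  coeff (n + 1) s.1 - longWordSum n fun i => if _h : (i : ℕ) < n then solveNat s i else 0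
termination_by n

/-- The coefficients of the solution `h ∈ L` of `P̂(e^h) = s`. -/
def solveSeq (s : ReturnSeries) : ℕ+ → ℂ := fun i => solveNat s i

theorem continuous_solveNat (n : ℕ) : Continuous fun s => solveNat s n := by
  induction n using Nat.strong_induction_on with
  | _ n ih =>
    simp_rw [solveNat.eq_def _ n]
    refine (continuous_coeff_returnSeries (n + 1)).sub ((continuous_longWordSum n).comp
      (continuous_pi fun i => ?_))
    split_ifs with h
    · exact ih i h
    · exact continuous_const

theorem continuous_solveSeq : Continuous solveSeq :=
  continuous_pi fun i => continuous_solveNat i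

/-- The element `e^h`, `h ∈ L`, with a given first return map. -/
def expLift (s : ReturnSeries) : SeriesGroup := expG (linearElement (solveSeq s))

theorem continuous_expLift : Continuous expLift :=
  continuous_expG_linearElement.comp continuous_solveSeq

theorem expLift_mem_PL (s : ReturnSeries) : expLift s ∈ PL := expG_linearElement_mem_PL _

theorem firstReturn_expLift (s : ReturnSeries) : firstReturn (expLift s) = s := by
  refine ReturnSeries.ext fun n => ?_
  rw [coeff_firstReturn]
  rcases n with _ | n
  · rw [transferCoeff_zero]
    exact s.2.2.symm
  · have h := transferCoeff_expG n.succPNat (solveSeq s)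
    rw [Nat.succPNat_coe] at h
    rw [expLift, h, solveSeq, Nat.succPNat_coe, solveNat, sub_add_eq_add_sub, sub_eq_iff_eq_add]
    congr 1
    refine longWordSum_congr fun i hi => ?_
    rw [dif_pos hi]
    rfl

/-- Equal first return maps force equal images under `Ψ`, and the logarithm then recovers the
element of `L`; here it must be zero. -/
theorem expLift_identity : expLift ReturnSeries.identity = 1 := by
  have h : PsiG (expLift ReturnSeries.identity) = PsiG 1 :=
    (isMultiplicative_of_mem_PL (expLift_mem_PL _)).PsiG_eq isMultiplicative_one
      (by rw [firstReturn_expLift, firstReturn_one])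
  rw [← expG_linearElement_zero] at h ⊢
  have h2 := congrArg (fun σ => liftA (logSeries σ)) h
  simp only [expLift, liftA_logSeries_PsiG_expG] at h2
  rw [expLift, h2]

theorem PsiG_expLift_firstReturn {g : SeriesGroup} (hg : IsMultiplicative g) :
    PsiG (expLift (firstReturn g)) = PsiG g :=
  (isMultiplicative_of_mem_PL (expLift_mem_PL _)).PsiG_eq hg (firstReturn_expLift _)

/-! ### The maps `Φ`, `T_PL` and `s` -/

section

variable {T : ℝ}

/-- `Phi` evaluates `P̂` at a chosen preimage; the choice is immaterial because `P̂` depends only on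
`Ψ`. -/
theorem firstReturn_eq_Phi {g : SeriesGroup} (hg : g ∈ formalPathGroup T) :
    firstReturn g = Phi T (PsiG g) :=
  firstReturn_eq_of_PsiG_eq
    (Function.invFunOn_eq (f := PsiG) (s := (formalPathGroup T : Set SeriesGroup))
      ⟨g, hg, rfl⟩).symm

theorem bijOn_Phi (hT : 0 < T) : Set.BijOn (Phi T) (pathOperators T) Set.univ := by
  refine ⟨fun _ _ => Set.mem_univ _, ?_, ?_⟩
  · rintro _ ⟨g, hg, rfl⟩ _ ⟨h, hh, rfl⟩ e
    rw [← firstReturn_eq_Phi hg, ← firstReturn_eq_Phi hh] at e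
    exact (isMultiplicative_of_mem_formalPathGroup hT hg).PsiG_eq
      (isMultiplicative_of_mem_formalPathGroup hT hh) e
  · intro s _
    have h := PL_le_formalPathGroup hT (expLift_mem_PL s)
    exact ⟨_, ⟨_, h, rfl⟩, by rw [← firstReturn_eq_Phi h, firstReturn_expLift]⟩

theorem PhiInv_eq (hT : 0 < T) (s : ReturnSeries) : PhiInv T s = PsiG (expLift s) := by
  have h := PL_le_formalPathGroup hT (expLift_mem_PL s)
  have hex : ∃ σ ∈ pathOperators T, Phi T σ = s :=
    ⟨_, ⟨_, h, rfl⟩, by rw [← firstReturn_eq_Phi h, firstReturn_expLift]⟩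
  refine (bijOn_Phi hT).injOn (Function.invFunOn_mem hex) ⟨_, h, rfl⟩ ?_
  rw [← firstReturn_eq_Phi h, firstReturn_expLift]
  exact Function.invFunOn_eq hex

theorem TPL_eq (hT : 0 < T) (s : ReturnSeries) : TPL T s = expLift s := by
  rw [TPL, PhiInv_eq hT, expLift, liftA_logSeries_PsiG_expG]

/-- `e^a e^b` and the section at its first return map have the same image under `Ψ`, and the
definition of `s(a, b)` sees only that image. -/
theorem expG_sL {a b : seriesLie} (ha : a ∈ L) (hb : b ∈ L) :
    expG (sL a b) = expLift (firstReturn (expG a * expG b)) := by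
  have h : IsMultiplicative (expG a * expG b) := by
    obtain ⟨a, rfl⟩ := ha
    obtain ⟨b, rfl⟩ := hb
    exact isMultiplicative_of_mem_PL
      (mul_mem (expG_linearElement_mem_PL a) (expG_linearElement_mem_PL b))
  rw [sL_eq, ← PsiG_expLift_firstReturn h, expLift, liftA_logSeries_PsiG_expG]

theorem mem_formalCenters_iff (hT : 0 < T) {g : SeriesGroup} : g ∈ formalCenters T ↔
    g ∈ formalPathGroup T ∧ firstReturn g = ReturnSeries.identity := by
  rw [formalCenters, Subgroup.mem_inf, MonoidHom.mem_ker]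
  refine and_congr_right fun hg => ⟨fun h => ?_, fun h => ?_⟩
  · rw [← firstReturn_one]
    exact firstReturn_eq_of_PsiG_eq (h.trans (map_one PsiG).symm)
  · rw [← map_one PsiG]
    exact (isMultiplicative_of_mem_formalPathGroup hT hg).PsiG_eq isMultiplicative_one
      (h.trans firstReturn_one.symm)

theorem mem_plCenters_iff (hT : 0 < T) {g : SeriesGroup} :
    g ∈ plCenters T ↔ g ∈ PL ∧ PsiG g = 1 := by
  rw [plCenters, formalCenters, Subgroup.mem_inf, Subgroup.mem_inf, MonoidHom.mem_ker]
  exact ⟨fun h => ⟨h.2, h.1.2⟩, fun h => ⟨⟨PL_le_formalPathGroup hT h.1, h.2⟩, h.1⟩⟩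

/-! ### The centers in `PL` -/

/-- The projection of `G` that sends a product of `e^h` and a center to the center. -/
def centerPart (g : SeriesGroup) : SeriesGroup := (expLift (firstReturn g))⁻¹ * g

theorem continuous_centerPart : Continuous centerPart :=
  (continuous_expLift.comp continuous_firstReturn).inv.mul continuous_id

theorem centerPart_mem (hT : 0 < T) {g : SeriesGroup} (hg : g ∈ PL) :
    centerPart g ∈ plCenters T := by
  refine (mem_plCenters_iff hT).2 ⟨mul_mem (inv_mem (expLift_mem_PL _)) hg, ?_⟩
  rw [centerPart, map_mul, ← PsiG_expLift_firstReturn (isMultiplicative_of_mem_PL hg), ← map_mul,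
    inv_mul_cancel, map_one]

/-- For a formal center the exponential factor is the section at `r`, which is trivial. -/
theorem centerPart_of_mem (hT : 0 < T) {g : SeriesGroup} (hg : g ∈ formalCenters T) :
    centerPart g = g := by
  rw [centerPart, ((mem_formalCenters_iff hT).1 hg).2, expLift_identity, inv_one, one_mul]

theorem firstReturn_expLift_mul (s : ReturnSeries) {g : SeriesGroup} (hg : PsiG g = 1) :
    firstReturn (expLift s * g) = s := by
  rw [firstReturn_eq_of_PsiG_eq (h := expLift s) (by rw [map_mul, hg, mul_one]),
    firstReturn_expLift]

/-- The decomposition of `PL` into exponentials and centers. -/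
def plHomeomorph (hT : 0 < T) : ReturnSeries × plCenters T ≃ₜ PL where
  toFun p := ⟨expLift p.1 * p.2.1,
    mul_mem (expLift_mem_PL _) ((mem_plCenters_iff hT).1 p.2.2).1⟩
  invFun x := (firstReturn x.1, ⟨centerPart x.1, centerPart_mem hT x.2⟩)
  left_inv := by
    rintro ⟨s, g, hg⟩
    have h := firstReturn_expLift_mul s ((mem_plCenters_iff hT).1 hg).2
    refine Prod.ext h (Subtype.ext ?_)
    simp only [centerPart, h, inv_mul_cancel_left]
  right_inv := by
    rintro ⟨x, hx⟩
    exact Subtype.ext (mul_inv_cancel_left _ _)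
  continuous_toFun := ((continuous_expLift.comp continuous_fst).mul
    (continuous_subtype_val.comp continuous_snd)).subtype_mk _
  continuous_invFun := (continuous_firstReturn.comp continuous_subtype_val).prodMk
    ((continuous_centerPart.comp continuous_subtype_val).subtype_mk _)

theorem plCenters_eq_closure (hT : 0 < T) : plCenters T =
    Subgroup.closure {x | ∃ a ∈ L, ∃ b ∈ L, x = expG a * expG b * expG (-sL a b)} := by
  set N := Subgroup.closure {x | ∃ a ∈ L, ∃ b ∈ L, x = expG a * expG b * expG (-sL a b)} with hN
  have hmul : ∀ a ∈ L, ∀ b ∈ L, ∃ n ∈ N, ∃ s, expG a * expG b = n * expLift s := by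
    intro a ha b hb
    refine ⟨_, Subgroup.subset_closure ⟨a, ha, b, hb, rfl⟩, firstReturn (expG a * expG b), ?_⟩
    rw [← expG_sL ha hb, expG_neg, inv_mul_cancel_right]
  -- Induction by right multiplication: the new exponential is merged with the current one, and the
  -- resulting generator is absorbed on the left, so normality of `N` is not needed.
  have hPL : ∀ x ∈ PL, ∃ n ∈ N, ∃ s, x = n * expLift s := by
    have hstep : ∀ (x : SeriesGroup) (b : ℕ+ → ℂ), (∃ n ∈ N, ∃ s, x = n * expLift s) →
        ∃ n ∈ N, ∃ s, x * expG (linearElement b) = n * expLift s := by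
      rintro _ b ⟨n, hn, s, rfl⟩
      obtain ⟨n', hn', s', h⟩ := hmul _ ⟨solveSeq s, rfl⟩ _ ⟨b, rfl⟩
      exact ⟨n * n', mul_mem hn hn', s', by rw [mul_assoc, mul_assoc, ← h, expLift]⟩
    intro x hx
    induction hx using Subgroup.closure_induction_right with
    | one => exact ⟨1, one_mem _, ReturnSeries.identity, by rw [expLift_identity, one_mul]⟩
    | mul_right x _ y hy ih =>
      obtain ⟨_, ⟨c, rfl⟩, rfl⟩ := hy
      exact hstep x c ih
    | mul_inv_cancel x _ y hy ih =>
      obtain ⟨_, ⟨c, rfl⟩, rfl⟩ := hy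
      rw [← expG_neg, ← linearElement_neg]
      exact hstep x (-c) ih
  have hle : N ≤ plCenters T := by
    rw [hN, Subgroup.closure_le]
    rintro _ ⟨a, ha, b, hb, rfl⟩
    have hab : expG a * expG b ∈ PL :=
      mul_mem (Subgroup.subset_closure ⟨a, ha, rfl⟩) (Subgroup.subset_closure ⟨b, hb, rfl⟩)
    rw [expG_neg, expG_sL ha hb]
    refine (mem_plCenters_iff hT).2 ⟨mul_mem hab (inv_mem (expLift_mem_PL _)), ?_⟩
    rw [map_mul, ← PsiG_expLift_firstReturn (isMultiplicative_of_mem_PL hab), ← map_mul,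
      mul_inv_cancel, map_one]
  refine le_antisymm (fun x hx => ?_) hle
  obtain ⟨hx, hx1⟩ := (mem_plCenters_iff hT).1 hx
  obtain ⟨n, hn, s, rfl⟩ := hPL x hx
  -- Applying `Ψ` kills both the center `x` and the factor `n`, so the exponential factor has
  -- trivial first return map and is `1`.
  rw [map_mul, ((mem_plCenters_iff hT).1 (hle hn)).2, one_mul] at hx1
  have hs : s = ReturnSeries.identity := by
    rw [← firstReturn_expLift s, ← firstReturn_one]
    exact firstReturn_eq_of_PsiG_eq (hx1.trans (map_one PsiG).symm)
  rw [hs, expLift_identity, mul_one]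
  exact hn

theorem dense_plCenters (hT : 0 < T) :
    Dense (((plCenters T).subgroupOf (formalCenters T) : Subgroup (formalCenters T)) :
      Set (formalCenters T)) := by
  rintro ⟨x, hx⟩
  rw [IsInducing.subtypeVal.closure_eq_preimage_closure_image, Set.mem_preimage]
  have h : centerPart x ∈ closure (plCenters T : Set SeriesGroup) :=
    -- A formal center is a limit of elements of `PL`; its image under `centerPart` is a limit of
    -- centers in `PL`, and that image is the center itself.
    map_mem_closure continuous_centerPart (formalPathGroup_le_closure hT hx.1)
      fun g hg => centerPart_mem hT hg
  rw [centerPart_of_mem hT hx] at h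
  refine closure_mono (fun g hg => ?_) h
  exact ⟨⟨g, hg.1⟩, hg, rfl⟩

end

end CenterProblem

end

theorem proposition3p14 (T : ℝ) (hT : 0 < T) :
    -- the data are well defined: `PL` consists of formal paths, `Φ : S → G[[r]]` is a bijection
    -- with `P̂ = Φ ∘ Ψ`, and the formal centers are the formal paths with trivial first return map
    (CenterProblem.PL ≤ CenterProblem.formalPathGroup T ∧
      (∀ g ∈ CenterProblem.formalPathGroup T,
        CenterProblem.firstReturn g = CenterProblem.Phi T (CenterProblem.PsiG g)) ∧
      Set.BijOn (CenterProblem.Phi T) (CenterProblem.pathOperators T) Set.univ ∧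
      (∀ g : CenterProblem.SeriesGroup, g ∈ CenterProblem.formalCenters T ↔
        g ∈ CenterProblem.formalPathGroup T ∧
          CenterProblem.firstReturn g = CenterProblem.ReturnSeries.identity)) ∧
    (∃ Θ : CenterProblem.ReturnSeries × CenterProblem.plCenters T ≃ₜ CenterProblem.PL,
      ∀ (s : CenterProblem.ReturnSeries) (g : CenterProblem.plCenters T),
        (Θ (s, g) : CenterProblem.SeriesGroup) =
          CenterProblem.TPL T s * (g : CenterProblem.SeriesGroup)) ∧
    CenterProblem.plCenters T =
      Subgroup.closure {x | ∃ a ∈ CenterProblem.L, ∃ b ∈ CenterProblem.L,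
        x = CenterProblem.expG a * CenterProblem.expG b *
          CenterProblem.expG (-CenterProblem.sL a b)} ∧
    (CenterProblem.plCenters T ≤ CenterProblem.formalCenters T ∧
      Dense (((CenterProblem.plCenters T).subgroupOf (CenterProblem.formalCenters T) :
        Subgroup (CenterProblem.formalCenters T)) : Set (CenterProblem.formalCenters T))) := by
  open CenterProblem in
  exact ⟨⟨PL_le_formalPathGroup hT, fun g hg => firstReturn_eq_Phi hg, bijOn_Phi hT,
      fun g => mem_formalCenters_iff hT⟩,
    ⟨plHomeomorph hT, fun s g => by rw [TPL_eq hT]; rfl⟩,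
    plCenters_eq_closure hT, inf_le_left, dense_plCenters hT⟩
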